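/- **Setting.** Let $\mathcal C=\{x_1,\dots,x_M\}\subseteq\{0,1\}^n$ be a code of length $n\ge 1$ with $M\ge 1$ distinct codewords, and let $d_H$ be the Hamming distance. For a real $R$ and $L\in\mathbb N$, the code is *$(R,L)$-list-decodable* if every $y\in\{0,1\}^n$ has at most $L$ codewords $x\in\mathcal C$ with $d_H(x,y)\le R$. All $M$ codewords are sent over independent binary symmetric channels with crossover probability $p\in(0,1)$, and the outputs are received as a list $y_1,\dots,y_M$ in which $y_{\sigma(i)}$ is the output of $x_i$, for an unknown permutation $\sigma$ of $[M]$. Let $\mathcal G$ be the complete bipartite graph with left nodes $x_1,\dots,x_M$, right nodes $y_1,\dots,y_M$ and edge costs $d_H(x_i,y_j)$, and let $\mathcal H$ be its subgraph of the edges of cost at most $R$. A permutation $\tau$ is identified with the perfect matching $\{(x_i,y_{\tau(i)})\}$, whose cost is the sum of its edge costs. JMDI returns a minimum-cost perfect matching of $\mathcal G$; it *correctly finds* $\sigma$ if $\sigma$ is the unique minimum-cost perfect matching of $\mathcal G$. JLDI, given $x_1,\dots,x_M$, $y_1,\dots,y_M$ and $R$, returns a minimum-cost perfect matching of $\mathcal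 H$, or reports failure if $\mathcal H$ has no perfect matching; it *correctly finds* $\sigma$ if it returns $\sigma$. **Theorem.** There are an implementation of JLDI on a random access machine (uniform cost; addition, truncated subtraction, comparison and indirect addressing) and an absolute constant $K$ such that the following holds for all $M$, $n$, $p$ as above, all $L\in\mathbb N$, all real $R>pn$ and every $(R,L)$-list-decodable code $\mathcal C$ of length $n$ and size $M$. Put $\gamma=R/(pn)-1>0$. 1. On all channel outputs, JLDI terminates within $K\,M^2(\log M+L+n)$ steps. 2. For every $\sigma$, the event that JMDI correctly finds $\sigma$ has positive probability, and $$\Pr[\text{JLDI correctly finds }\sigma\mid\text{JMDI correctly finds }\sigma]\ \ge\ \left(1-e^{-\gamma^2pn/3}\right)^M\quad\text{if }\gamma\le 1,$$ while for every $\gamma>0$ $$\Pr[\text{JLDI correctly finds }\sigma\mid\text{JMDI correctly finds }\sigma]\ \ge\ \left(1-e^{-\gamma^2pn/(2+\gamma)}\right)^M .$$ -/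

import Mathlib

/-! ### Words, list-decodable codes, and the binary symmetric channel -/

/-- Binary words of length `n`. -/
abbrev Word (n : ℕ) : Type := Fin n → Bool

/-- `C` is `(R, L)`-list-decodable: every Hamming ball of radius `R` contains at most `L`
codewords. -/
def IsListDecodable {n : ℕ} (C : Set (Word n)) (R : ℝ) (L : ℕ) : Prop :=
  ∀ y : Word n, {c | c ∈ C ∧ (hammingDist c y : ℝ) ≤ R}.ncard ≤ L

/-- The probability `P(y | x)` of receiving `y` when `x` is sent over a BSC with crossover
probability `p`. -/
noncomputable def bscProb {n : ℕ} (p : ℝ) (x y : Word n) : ℝ :=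
  ∏ k, if y k = x k then 1 - p else p

open Classical in
/-- All the words `x i` are sent over independent copies of the BSC, and the output of `x i` is
listed as `y (σ i)`. This is the probability that the list `y` of outputs satisfies `E`. -/
noncomputable def outputProb {M n : ℕ} (p : ℝ) (x : Fin M → Word n) (σ : Equiv.Perm (Fin M))
    (E : (Fin M → Word n) → Prop) : ℝ :=
  ∑ y with E y, ∏ i, bscProb p (x i) (y (σ i))

/-- Conditional probability of `A` given `B` for the list of outputs. -/
noncomputable def condOutputProb {M n : ℕ} (p : ℝ) (x : Fin M → Word n)
    (σ : Equiv.Perm (Fin M)) (A B : (Fin M → Word n) → Prop) : ℝ :=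
  outputProb p x σ (fun y => A y ∧ B y) / outputProb p x σ B

/-! ### Balanced bipartite graphs with costs; perfect matchings as permutations -/

/-- A balanced bipartite graph of order `M` with a cost on each edge. The value of `cost` off the
edges is irrelevant. -/
structure CostBipartite (M : ℕ) where
  /-- `Adj i j`: the left node `i` is joined to the right node `j`. -/
  Adj : Fin M → Fin M → Prop
  /-- The cost of the edge from the left node `i` to the right node `j`. -/
  cost : Fin M → Fin M → ℕ

namespace CostBipartite

variable {M : ℕ} (G : CostBipartite M)

/-- The permutation `τ` is a perfect matching: every pair `(i, τ i)` is an edge. -/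
def IsPerfectMatching (τ : Equiv.Perm (Fin M)) : Prop := ∀ i, G.Adj i (τ i)

/-- The total cost of the edges `(i, τ i)`. -/
def matchingCost (τ : Equiv.Perm (Fin M)) : ℕ := ∑ i, G.cost i (τ i)

/-- `τ` is a minimum-cost perfect matching. -/
def IsMinCostMatching (τ : Equiv.Perm (Fin M)) : Prop :=
  G.IsPerfectMatching τ ∧ ∀ τ', G.IsPerfectMatching τ' → G.matchingCost τ ≤ G.matchingCost τ'

/-- `τ` is the only minimum-cost perfect matching. -/
def IsUniqueMinCostMatching (τ : Equiv.Perm (Fin M)) : Prop :=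
  G.IsMinCostMatching τ ∧ ∀ τ', G.IsMinCostMatching τ' → τ' = τ

end CostBipartite

/-- The complete input-output graph of JMDI, with Hamming distances as costs. -/
def jmdiGraph {M n : ℕ} (x y : Fin M → Word n) : CostBipartite M where
  Adj _ _ := True
  cost i j := hammingDist (x i) (y j)

/-- The input-output graph of JLDI: only the edges of cost at most `R` are kept. -/
def jldiGraph {M n : ℕ} (x y : Fin M → Word n) (R : ℝ) : CostBipartite M where
  Adj i j := (hammingDist (x i) (y j) : ℝ) ≤ R
  cost i j := hammingDist (x i) (y j)

/-- JMDI correctly finds `σ`: the minimum-cost matching of its graph is unambiguous and is `σ`. -/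
def JMDICorrect {M n : ℕ} (x y : Fin M → Word n) (σ : Equiv.Perm (Fin M)) : Prop :=
  (jmdiGraph x y).IsUniqueMinCostMatching σ

/-! ### A random access machine

Programs are `while`-programs over random access memory (registers and arrays of natural numbers)
with addition, truncated subtraction and comparisons. A program is a finite syntactic object, fixed
independently of the input. Under the uniform cost criterion, every arithmetic operation,
comparison, constant, register access and memory access costs one step, as do the assignments. -/

namespace RAM

/-- The memory: registers and arrays. -/
structure State where
  /-- The registers. -/
  reg : ℕ → ℕ
  /-- The arrays: `arr a q` is the cell `q` of the array `a`. -/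
  arr : ℕ → ℕ → ℕ

/-- Expressions. -/
inductive Expr where
  | lit (c : ℕ)
  | reg (v : ℕ)
  | read (a : ℕ) (e : Expr)
  | add (e f : Expr)
  | sub (e f : Expr)
  | lt (e f : Expr)
  | eq (e f : Expr)

/-- The value of an expression; comparisons have the value `1` or `0`. -/
def Expr.eval (s : State) : Expr → ℕ
  | .lit c => c
  | .reg v => s.reg v
  | .read a e => s.arr a (e.eval s)
  | .add e f => e.eval s + f.eval s
  | .sub e f => e.eval s - f.eval s
  | .lt e f => if e.eval s < f.eval s then 1 else 0
  | .eq e f => if e.eval s = f.eval s then 1 else 0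

/-- The number of elementary steps taken by the evaluation of an expression. -/
def Expr.steps : Expr → ℕ
  | .lit _ => 1
  | .reg _ => 1
  | .read _ e => e.steps + 1
  | .add e f => e.steps + f.steps + 1
  | .sub e f => e.steps + f.steps + 1
  | .lt e f => e.steps + f.steps + 1
  | .eq e f => e.steps + f.steps + 1

/-- Programs. Tests succeed when the value of the expression is not `0`. -/
inductive Program where
  | skip
  | assign (v : ℕ) (e : Expr)
  | store (a : ℕ) (i e : Expr)
  | seq (c d : Program)
  | cond (e : Expr) (c d : Program)
  | loop (e : Expr) (c : Program)

/-- Put the value `k` into the register `v`. -/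
def State.setReg (s : State) (v k : ℕ) : State :=
  { s with reg := Function.update s.reg v k }

/-- Put the value `k` into the cell `q` of the array `a`. -/
def State.setArr (s : State) (a q k : ℕ) : State :=
  { s with arr := Function.update s.arr a (Function.update (s.arr a) q k) }

/-- `Exec c s t s'`: started in `s`, the program `c` halts after exactly `t` steps in `s'`. -/
inductive Exec : Program → State → ℕ → State → Prop where
  | skip (s : State) : Exec .skip s 1 s
  | assign (s : State) (v : ℕ) (e : Expr) :
      Exec (.assign v e) s (e.steps + 1) (s.setReg v (e.eval s))
  | store (s : State) (a : ℕ) (i e : Expr) :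
      Exec (.store a i e) s (i.steps + e.steps + 1) (s.setArr a (i.eval s) (e.eval s))
  | seq {c d : Program} {s s' s'' : State} {t t' : ℕ} :
      Exec c s t s' → Exec d s' t' s'' → Exec (.seq c d) s (t + t') s''
  | condTrue {e : Expr} {c d : Program} {s s' : State} {t : ℕ} :
      e.eval s ≠ 0 → Exec c s t s' → Exec (.cond e c d) s (e.steps + t) s'
  | condFalse {e : Expr} {c d : Program} {s s' : State} {t : ℕ} :
      e.eval s = 0 → Exec d s t s' → Exec (.cond e c d) s (e.steps + t) s'
  | loopTrue {e : Expr} {c : Program} {s s' s'' : State} {t t' : ℕ} :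
      e.eval s ≠ 0 → Exec c s t s' → Exec (.loop e c) s' t' s'' →
      Exec (.loop e c) s (e.steps + t + t') s''
  | loopFalse {e : Expr} {c : Program} {s : State} :
      e.eval s = 0 → Exec (.loop e c) s e.steps s

/-- A list of `M` words of length `n` as an array of bits, word after word, followed by zeros. -/
def wordsArray {M n : ℕ} (w : Fin M → Word n) (q : ℕ) : ℕ :=
  if h : q / n < M ∧ q % n < n then (w ⟨q / n, h.1⟩ ⟨q % n, h.2⟩).toNat else 0

/-- The initial memory: `M`, `n` and the integer part of `R` in the registers `0`, `1`, `2`, the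
codewords in the array `0`, the channel outputs in the array `1`, and `0` everywhere else. -/
noncomputable def input {M n : ℕ} (x y : Fin M → Word n) (R : ℝ) : State where
  reg v := if v = 0 then M else if v = 1 then n else if v = 2 then ⌊R⌋₊ else 0
  arr a q := if a = 0 then wordsArray x q else if a = 1 then wordsArray y q else 0

/-- Reading the result off the final memory: register `3` is `0` for a declared failure, and is `1`
if the array `2` lists the values of a permutation. -/
def State.HasOutput {M : ℕ} (s : State) : Option (Equiv.Perm (Fin M)) → Prop
  | none => s.reg 3 = 0
  | some τ => s.reg 3 = 1 ∧ ∀ i : Fin M, s.arr 2 i = τ i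

/-- On the codewords `x`, the outputs `y` and the radius `R`, the program halts after exactly `t`
steps with the result `o`. -/
def Returns {M n : ℕ} (c : Program) (x y : Fin M → Word n) (R : ℝ) (t : ℕ)
    (o : Option (Equiv.Perm (Fin M))) : Prop :=
  ∃ s, Exec c (input x y R) t s ∧ s.HasOutput o

end RAM

/-- The results that JLDI may give: a minimum-cost perfect matching of its graph, or failure if the
graph has no perfect matching. -/
def IsJLDIResult {M n : ℕ} (x y : Fin M → Word n) (R : ℝ) :
    Option (Equiv.Perm (Fin M)) → Prop
  | none => ∀ τ, ¬ (jldiGraph x y R).IsPerfectMatching τ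
  | some τ => (jldiGraph x y R).IsMinCostMatching τ

/-! Running time. All M² distances are computed in time O(M²n). Each channel output lies within R of
at most L codewords, so the graph has at most ML edges (`IsListDecodable.sum_le`). A matching is
then grown row by row along shortest augmenting paths. Prices on the columns act as dual variables:
every matched edge minimises cost plus price in its row. Hence the reduced costs met by the search
are nonnegative, and a perfect matching supported by prices is optimal, because the prices cancel
when two perfect matchings are compared (`EdgeList.IsMatching.optimal`). If a search ends without a
free column, the row being matched and the rows matched to visited columns violate Hall's condition
(`EdgeList.Tree.not_perfect`).

Along an alternating path, length and price differ by at most n per visited column. This keeps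
prices below 2nM and path lengths below 4nM, inclusive, through all stages
(`EdgeList.Found.newPrice_le`, `EdgeList.Tree.key_le`). An array of buckets indexed by length
therefore replaces the heap in Dijkstra's algorithm, and each of the M stages takes O(nM + ML)
steps. The total is O(M²(n + L)), even without the term log M.

Execution is symbolic, by weakest preconditions. In `wp_loop` the invariant carries a potential
bounding the time left, so correctness, termination and amortised cost are proved together.

Probability. The channel is described by the pattern of correctly transmitted bits, under a product
measure. Two events are increasing in this pattern: that every word has at most R errors, and that
JMDI finds σ. For the second, correcting k bits lowers the cost of σ by exactly k and that of any
other matching by at most k (`JMDICorrect.mono`). Harris' inequality (`outputProb_mul_le`) then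
shows that conditioning on the second event does not decrease the probability of the first, which is
a product of M factors controlled by a Chernoff bound (`sum_bscProb_tail_le`). When both events
occur, σ survives in the smaller graph and is strictly cheapest there, so JLDI must return it
(`IsJLDIResult.eq_some`). -/

namespace RAM

/-! ### Symbolic execution of programs -/

/-- Weakest precondition: started in `s`, the program `c` halts after some number `t` of steps in
a state `s'` with `Q s' t`. -/
def wp (c : Program) (s : State) (Q : State → ℕ → Prop) : Prop :=
  ∃ t s', Exec c s t s' ∧ Q s' t

theorem wp.mono {c : Program} {s : State} {Q Q' : State → ℕ → Prop} (h : wp c s Q)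
    (hQ : ∀ s' t, Q s' t → Q' s' t) : wp c s Q' := by
  obtain ⟨t, s', he, hq⟩ := h
  exact ⟨t, s', he, hQ _ _ hq⟩

/-- This rule and the next ones are equivalences so that `simp only` can run loop-free code
symbolically; only loops need an invariant. -/
theorem wp_skip {s : State} {Q : State → ℕ → Prop} : wp .skip s Q ↔ Q s 1 := by
  constructor
  · rintro ⟨t, s', he, hq⟩
    cases he
    exact hq
  · exact fun h => ⟨_, _, .skip s, h⟩

theorem wp_assign {s : State} {v : ℕ} {e : Expr} {Q : State → ℕ → Prop} :
    wp (.assign v e) s Q ↔ Q (s.setReg v (e.eval s)) (e.steps + 1) := by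
  constructor
  · rintro ⟨t, s', he, hq⟩
    cases he
    exact hq
  · exact fun h => ⟨_, _, .assign s v e, h⟩

theorem wp_store {s : State} {a : ℕ} {i e : Expr} {Q : State → ℕ → Prop} :
    wp (.store a i e) s Q ↔
      Q (s.setArr a (i.eval s) (e.eval s)) (i.steps + e.steps + 1) := by
  constructor
  · rintro ⟨t, s', he, hq⟩
    cases he
    exact hq
  · exact fun h => ⟨_, _, .store s a i e, h⟩

theorem wp_seq {s : State} {c d : Program} {Q : State → ℕ → Prop} :
    wp (.seq c d) s Q ↔ wp c s (fun s' t => wp d s' (fun s'' t' => Q s'' (t + t'))) := by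
  constructor
  · rintro ⟨t, s', he, hq⟩
    cases he with
    | seq h1 h2 => exact ⟨_, _, h1, _, _, h2, hq⟩
  · rintro ⟨t, s', h1, t', s'', h2, hq⟩
    exact ⟨_, _, .seq h1 h2, hq⟩

theorem wp_cond {s : State} {e : Expr} {c d : Program} {Q : State → ℕ → Prop} :
    wp (.cond e c d) s Q ↔
      (e.eval s ≠ 0 → wp c s (fun s' t => Q s' (e.steps + t))) ∧
      (e.eval s = 0 → wp d s (fun s' t => Q s' (e.steps + t))) := by
  constructor
  · rintro ⟨t, s', he, hq⟩
    cases he with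
    | condTrue h h1 => exact ⟨fun _ => ⟨_, _, h1, hq⟩, fun h' => absurd h' h⟩
    | condFalse h h1 => exact ⟨fun h' => absurd h h', fun _ => ⟨_, _, h1, hq⟩⟩
  · rintro ⟨h1, h2⟩
    by_cases h : e.eval s = 0
    · obtain ⟨t, s', he, hq⟩ := h2 h
      exact ⟨_, _, .condFalse h he, hq⟩
    · obtain ⟨t, s', he, hq⟩ := h1 h
      exact ⟨_, _, .condTrue h he, hq⟩

/-- The registers that a program may write. -/
def Program.regs : Program → List ℕ
  | .skip => []
  | .assign v _ => [v]
  | .store _ _ _ => []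
  | .seq c d => c.regs ++ d.regs
  | .cond _ c d => c.regs ++ d.regs
  | .loop _ c => c.regs

/-- The arrays that a program may write. -/
def Program.arrs : Program → List ℕ
  | .skip => []
  | .assign _ _ => []
  | .store a _ _ => [a]
  | .seq c d => c.arrs ++ d.arrs
  | .cond _ c d => c.arrs ++ d.arrs
  | .loop _ c => c.arrs

/-- The states `s` and `s'` agree on everything that the program `c` cannot write. -/
structure Frame (c : Program) (s s' : State) : Prop where
  reg : ∀ v, v ∉ c.regs → s'.reg v = s.reg v
  arr : ∀ a, a ∉ c.arrs → s'.arr a = s.arr a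

/-- The writable registers and arrays form explicit lists computed from the syntax, so for concrete
programs the side conditions of a frame are settled by `decide`. -/
theorem Exec.frame {c : Program} {s s' : State} {t : ℕ} (h : Exec c s t s') : Frame c s s' := by
  induction h with
  | skip s => exact ⟨fun _ _ => rfl, fun _ _ => rfl⟩
  | assign s v e =>
    refine ⟨fun u hu => ?_, fun _ _ => rfl⟩
    simp only [Program.regs, List.mem_singleton] at hu
    simp [State.setReg, hu]
  | store s a i e =>
    refine ⟨fun _ _ => rfl, fun b hb => ?_⟩
    simp only [Program.arrs, List.mem_singleton] at hb
    simp [State.setArr, hb]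
  | seq _ _ h1 h2 =>
    constructor
    · intro v hv
      simp only [Program.regs, List.mem_append, not_or] at hv
      rw [h2.reg v hv.2, h1.reg v hv.1]
    · intro v hv
      simp only [Program.arrs, List.mem_append, not_or] at hv
      rw [h2.arr v hv.2, h1.arr v hv.1]
  | condTrue _ _ h1 =>
    constructor
    · intro v hv
      simp only [Program.regs, List.mem_append, not_or] at hv
      exact h1.reg v hv.1
    · intro v hv
      simp only [Program.arrs, List.mem_append, not_or] at hv
      exact h1.arr v hv.1
  | condFalse _ _ h1 =>
    constructor
    · intro v hv
      simp only [Program.regs, List.mem_append, not_or] at hv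
      exact h1.reg v hv.2
    · intro v hv
      simp only [Program.arrs, List.mem_append, not_or] at hv
      exact h1.arr v hv.2
  | loopTrue _ _ _ h1 h2 =>
    exact ⟨fun v hv => (h2.reg v hv).trans (h1.reg v hv),
      fun v hv => (h2.arr v hv).trans (h1.arr v hv)⟩
  | loopFalse _ => exact ⟨fun _ _ => rfl, fun _ _ => rfl⟩

/-- What a program cannot write is unchanged in its final state. -/
theorem wp_of_frame {c : Program} {s : State} {Q : State → ℕ → Prop}
    (h : wp c s (fun s' t => Frame c s s' → Q s' t)) : wp c s Q := by
  obtain ⟨t, s', he, hq⟩ := h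
  exact ⟨t, s', he, hq he.frame⟩

theorem Expr.steps_pos (e : Expr) : 0 < e.steps := by
  cases e <;> simp [Expr.steps]

/-- The rule for loops: `I s m` is an invariant, in which `m` bounds the time still to be spent. -/
theorem wp_loop {e : Expr} {c : Program} {s₀ : State} {Q : State → ℕ → Prop}
    (I : State → ℕ → Prop) (m₀ : ℕ) (base : I s₀ m₀)
    (step : ∀ s m, Frame c s₀ s → I s m → e.eval s ≠ 0 →
      wp c s (fun s' t => Frame c s₀ s' → ∃ m', I s' m' ∧ e.steps + t + m' ≤ m))
    (post : ∀ s m t, Frame c s₀ s → I s m → e.eval s = 0 → t + m ≤ m₀ + e.steps → Q s t) :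
    wp (.loop e c) s₀ Q := by
  suffices H : ∀ m s, Frame c s₀ s → I s m →
      wp (.loop e c) s (fun s' t => ∃ m', Frame c s₀ s' ∧ I s' m' ∧ e.eval s' = 0 ∧
        t + m' ≤ m + e.steps) by
    refine (H m₀ s₀ ⟨fun _ _ => rfl, fun _ _ => rfl⟩ base).mono ?_
    rintro s' t ⟨m', h1, h2, h3, h4⟩
    exact post s' m' t h1 h2 h3 h4
  intro m
  induction m using Nat.strong_induction_on with
  | _ m ih =>
    intro s hf hI
    by_cases he : e.eval s = 0
    · exact ⟨_, _, .loopFalse he, m, hf, hI, he, by omega⟩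
    · obtain ⟨t, s', hx, hs'⟩ := step s m hf hI he
      have hf' : Frame c s₀ s' :=
        ⟨fun v hv => (hx.frame.reg v hv).trans (hf.reg v hv),
          fun v hv => (hx.frame.arr v hv).trans (hf.arr v hv)⟩
      obtain ⟨m', hI', hm'⟩ := hs' hf'
      -- A test costs at least one step, so the potential drops strictly and serves as the
      -- termination measure too.
      have := e.steps_pos
      obtain ⟨t', s'', hx', m'', h1, h2, h3, h4⟩ := ih m' (by omega) s' hf' hI'
      exact ⟨_, _, .loopTrue he hx hx', m'', h1, h2, h3, by omega⟩

theorem State.setReg_reg (s : State) (v k u : ℕ) :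
    (s.setReg v k).reg u = if u = v then k else s.reg u := by
  simp [State.setReg, Function.update_apply]

theorem State.setReg_arr (s : State) (v k a : ℕ) : (s.setReg v k).arr a = s.arr a := rfl

theorem State.setArr_reg (s : State) (a q k u : ℕ) : (s.setArr a q k).reg u = s.reg u := rfl

theorem State.setArr_arr (s : State) (a q k b : ℕ) :
    (s.setArr a q k).arr b = if b = a then Function.update (s.arr a) q k else s.arr b := by
  by_cases h : b = a
  · subst h
    simp [State.setArr]
  · simp [State.setArr, h]

end RAM

namespace RAM

/-! ### The program

Registers: `0` number `M` of words, `1` their length `n`, `2` radius, `3` result, `4` row `i`,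
`5` column `j`, `6` and `7` positions of words, `8` position in a word or edge, `9` distance,
`10` first unused edge, `11` number of buckets, `12` row to be matched, `13` level, `14` loop flag,
`15` edge, `16` stamp, `17` success flag, `18` and `19` offsets of the keys, `20` edge pointer,
`21` loop counter, `22` key, `23` loop flag.

Arrays: `0` codewords, `1` outputs, `2` result, `3` first edges of the rows, `4` rows of the edges,
`5` columns of the edges, `6` costs of the edges, `7` prices of the columns, `8` edges matched to the
columns, `9` edges matched to the rows, `10` heads of the buckets, `11` successors in the buckets,
`12` parent edges of the columns, `13` stamps of the columns, `14` distances of the columns. The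
edges are numbered from `1`. -/

local notation:30 c:31 ";;" d:30 => Program.seq c d

/-- Put the edge `20` of the row `4` into the bucket of its key. -/
def scanBody : Program :=
  .assign 22 (.sub (.add (.add (.reg 18) (.read 6 (.reg 20))) (.read 7 (.read 5 (.reg 20))))
    (.reg 19)) ;;
  .store 11 (.reg 20) (.read 10 (.reg 22)) ;;
  .store 10 (.reg 22) (.reg 20) ;;
  .assign 20 (.add (.reg 20) (.lit 1))

/-- Put the edges of the row `4` into the buckets. -/
def scan : Program :=
  .assign 20 (.read 3 (.reg 4)) ;;
  .loop (.lt (.reg 20) (.read 3 (.add (.reg 4) (.lit 1)))) scanBody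

/-- Take the next edge from the buckets, and visit its column if that is new. -/
def searchBody : Program :=
  .cond (.eq (.read 10 (.reg 13)) (.lit 0))
    (.assign 13 (.add (.reg 13) (.lit 1)) ;; .assign 14 (.lt (.reg 13) (.reg 11)))
    (.assign 15 (.read 10 (.reg 13)) ;;
      .store 10 (.reg 13) (.read 11 (.reg 15)) ;;
      .assign 5 (.read 5 (.reg 15)) ;;
      .cond (.eq (.read 13 (.reg 5)) (.lit 0))
        (.assign 16 (.add (.reg 16) (.lit 1)) ;;
          .store 13 (.reg 5) (.reg 16) ;;
          .store 12 (.reg 5) (.reg 15) ;;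
          .store 14 (.reg 5) (.reg 13) ;;
          .cond (.eq (.read 8 (.reg 5)) (.lit 0))
            (.assign 17 (.lit 1) ;; .assign 14 (.lit 0))
            (.assign 18 (.reg 13) ;;
              .assign 19 (.add (.read 6 (.read 8 (.reg 5))) (.read 7 (.reg 5))) ;;
              .assign 4 (.read 4 (.read 8 (.reg 5))) ;;
              scan))
        .skip)

/-- Empty the buckets and erase the stamps. -/
def clear : Program :=
  .assign 21 (.lit 0) ;;
  .loop (.lt (.reg 21) (.reg 11))
    (.store 10 (.reg 21) (.lit 0) ;; .store 13 (.reg 21) (.lit 0) ;;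
      .assign 21 (.add (.reg 21) (.lit 1)))

/-- Shortest path search from the row `12` to a free column. -/
def search : Program :=
  .assign 17 (.lit 0) ;; .assign 13 (.lit 0) ;; .assign 16 (.lit 0) ;; .assign 14 (.lit 1) ;;
  .assign 18 (.lit 0) ;; .assign 19 (.lit 0) ;; .assign 4 (.reg 12) ;;
  scan ;;
  .loop (.reg 14) searchBody

/-- Raise the prices of the visited columns. -/
def reprice : Program :=
  .assign 21 (.lit 0) ;;
  .loop (.lt (.reg 21) (.reg 0))
    (.cond (.read 13 (.reg 21))
        (.store 7 (.reg 21) (.add (.read 7 (.reg 21)) (.sub (.reg 13) (.read 14 (.reg 21)))))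
        .skip ;;
      .assign 21 (.add (.reg 21) (.lit 1)))

/-- Match the column `5` through its parent edge. -/
def augmentBody : Program :=
  .assign 15 (.read 12 (.reg 5)) ;;
  .assign 4 (.read 4 (.reg 15)) ;;
  .assign 8 (.read 9 (.reg 4)) ;;
  .store 9 (.reg 4) (.reg 15) ;;
  .store 8 (.reg 5) (.reg 15) ;;
  .cond (.eq (.reg 4) (.reg 12))
    (.assign 14 (.lit 0))
    (.assign 5 (.read 5 (.reg 8)) ;; .store 8 (.reg 5) (.lit 0))

/-- Augment the matching along the path of parent edges that ends in the column `5`. -/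
def augment : Program :=
  .assign 14 (.lit 1) ;; .loop (.reg 14) augmentBody

/-- Match one more row. -/
def stage : Program :=
  clear ;; search ;;
  .cond (.reg 17)
    (reprice ;; augment ;;
      .assign 12 (.add (.reg 12) (.lit 1)) ;; .assign 23 (.lt (.reg 12) (.reg 0)))
    (.assign 23 (.lit 0))

/-- Compute the distance of two words. -/
def distance : Program :=
  .assign 9 (.lit 0) ;; .assign 8 (.lit 0) ;;
  .loop (.lt (.reg 8) (.reg 1))
    (.assign 9 (.add (.reg 9) (.sub (.lit 1)
        (.eq (.read 0 (.add (.reg 6) (.reg 8))) (.read 1 (.add (.reg 7) (.reg 8)))))) ;;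
      .assign 8 (.add (.reg 8) (.lit 1)))

/-- List the edge from the row `4` to the column `5`, if there is one. -/
def columnBody : Program :=
  distance ;;
  .cond (.lt (.reg 9) (.add (.reg 2) (.lit 1)))
    (.store 4 (.reg 10) (.reg 4) ;; .store 5 (.reg 10) (.reg 5) ;; .store 6 (.reg 10) (.reg 9) ;;
      .assign 10 (.add (.reg 10) (.lit 1)))
    .skip ;;
  .assign 7 (.add (.reg 7) (.reg 1)) ;;
  .assign 5 (.add (.reg 5) (.lit 1))

/-- List the edges of the row `4`. -/
def rowBody : Program :=
  .store 3 (.reg 4) (.reg 10) ;;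
  .assign 5 (.lit 0) ;; .assign 7 (.lit 0) ;;
  .loop (.lt (.reg 5) (.reg 0)) columnBody ;;
  .assign 6 (.add (.reg 6) (.reg 1)) ;;
  .assign 4 (.add (.reg 4) (.lit 1))

/-- List the edges of the graph. -/
def listEdges : Program :=
  .assign 10 (.lit 1) ;; .assign 4 (.lit 0) ;; .assign 6 (.lit 0) ;;
  .loop (.lt (.reg 4) (.reg 0)) rowBody ;;
  .store 3 (.reg 4) (.reg 10)

/-- Write down the result. -/
def writeResult : Program :=
  .assign 3 (.eq (.reg 12) (.reg 0)) ;;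
  .assign 21 (.lit 0) ;;
  .loop (.lt (.reg 21) (.reg 0))
    (.store 2 (.reg 21) (.read 5 (.read 9 (.reg 21))) ;;
      .assign 21 (.add (.reg 21) (.lit 1)))

/-- JLDI by successive shortest paths, with buckets as the priority queue. -/
def jldi : Program :=
  listEdges ;;
  .assign 11 (.add (.add (.add (.reg 6) (.reg 6)) (.add (.reg 6) (.reg 6))) (.lit 1)) ;;
  .assign 12 (.lit 0) ;; .assign 23 (.lit 1) ;;
  .loop (.reg 23) stage ;;
  writeResult

/-! ### Buckets -/

/-- The list `l` is stored as a linked list with head `h` and successor function `nx`. -/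
def Chain (nx : ℕ → ℕ) : ℕ → List ℕ → Prop
  | h, [] => h = 0
  | h, e :: l => h = e ∧ e ≠ 0 ∧ Chain nx (nx e) l

/-- All buckets share a single successor array; this is why a push onto one of them leaves the
others intact. -/
theorem Chain.update {nx : ℕ → ℕ} {e v : ℕ} {l : List ℕ} {h : ℕ} (hc : Chain nx h l)
    (he : e ∉ l) : Chain (Function.update nx e v) h l := by
  induction l generalizing h with
  | nil => exact hc
  | cons a l ih =>
    obtain ⟨h1, h2, h3⟩ := hc
    simp only [List.mem_cons, not_or] at he
    refine ⟨h1, h2, ?_⟩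
    rw [Function.update_of_ne (Ne.symm he.1)]
    exact ih h3 he.2

theorem Chain.eq_nil {nx : ℕ → ℕ} {l : List ℕ} (hc : Chain nx 0 l) : l = [] := by
  cases l with
  | nil => rfl
  | cons a l => exact absurd hc.1.symm hc.2.1

theorem Chain.eq_cons {nx : ℕ → ℕ} {h : ℕ} {l : List ℕ} (hc : Chain nx h l) (h0 : h ≠ 0) :
    ∃ l', l = h :: l' ∧ Chain nx (nx h) l' := by
  cases l with
  | nil => exact absurd hc h0
  | cons a l =>
    obtain ⟨h1, h2, h3⟩ := hc
    subst h1
    exact ⟨l, rfl, h3⟩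

/-- Each of the first `B` buckets `k` holds the list `ls k`. -/
def Buckets (B : ℕ) (s : State) (ls : ℕ → List ℕ) : Prop :=
  ∀ k < B, Chain (s.arr 11) (s.arr 10 k) (ls k)

/-- The number of edges in the first `B` buckets. -/
def queued (B : ℕ) (ls : ℕ → List ℕ) : ℕ := ∑ k ∈ Finset.range B, (ls k).length

theorem queued_update {B : ℕ} {ls : ℕ → List ℕ} {k : ℕ} (hk : k < B) (l : List ℕ) :
    queued B (Function.update ls k l) + (ls k).length = queued B ls + l.length := by
  unfold queued
  have hk' : k ∈ Finset.range B := Finset.mem_range.2 hk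
  rw [← Finset.add_sum_erase _ _ hk', ← Finset.add_sum_erase _ (fun k => (ls k).length) hk']
  have : ∑ x ∈ (Finset.range B).erase k, (Function.update ls k l x).length =
      ∑ x ∈ (Finset.range B).erase k, (ls x).length := by
    refine Finset.sum_congr rfl fun x hx => ?_
    rw [Function.update_of_ne (Finset.ne_of_mem_erase hx)]
  rw [this, Function.update_self]
  omega

/-- Each edge of the row is pushed onto the front of the bucket of its key. The push overwrites the
successor of the edge, which would destroy a list already containing it; `hnew` excludes this. Edges
must be nonzero because `0` ends a list. -/
theorem scan_spec {s : State} {B : ℕ} {ls : ℕ → List ℕ} {key : ℕ → ℕ} {a b : ℕ}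
    (hkey : ∀ e, key e = s.reg 18 + s.arr 6 e + s.arr 7 (s.arr 5 e) - s.reg 19)
    (ha : a = s.arr 3 (s.reg 4)) (hb : b = s.arr 3 (s.reg 4 + 1)) (hab : a ≤ b)
    (hlt : ∀ e, a ≤ e → e < b → e ≠ 0 ∧ key e < B)
    (hB : Buckets B s ls) (hnew : ∀ k < B, ∀ e ∈ ls k, ¬ (a ≤ e ∧ e < b)) :
    wp scan s (fun s' t => ∃ ls', Buckets B s' ls' ∧
      (∀ k < B, ∀ e, e ∈ ls' k ↔ e ∈ ls k ∨ (a ≤ e ∧ e < b ∧ k = key e)) ∧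
      queued B ls' = queued B ls + (b - a) ∧ t ≤ 40 * (b - a) + 20) := by
  simp only [scan, wp_seq, wp_assign, Expr.eval, Expr.steps]
  refine wp_loop (fun s' m => ∃ ls', Buckets B s' ls' ∧ a ≤ s'.reg 20 ∧ s'.reg 20 ≤ b ∧
      (∀ k < B, ∀ e, e ∈ ls' k ↔ e ∈ ls k ∨ (a ≤ e ∧ e < s'.reg 20 ∧ k = key e)) ∧
      queued B ls' = queued B ls + (s'.reg 20 - a) ∧ m = 40 * (b - s'.reg 20))
      (40 * (b - a)) ?_ ?_ ?_
  · refine ⟨ls, hB, ?_⟩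
    simp only [State.setReg_reg, if_true, ← ha]
    refine ⟨le_rfl, hab, fun k _ e => ⟨Or.inl, ?_⟩, by omega, trivial⟩
    rintro (h | h)
    · exact h
    · omega
  · rintro s' m hf ⟨ls', h1, h2, h3, h4, h5, h6⟩ hlt'
    have r4 := hf.reg 4 (by decide)
    have r18 := hf.reg 18 (by decide)
    have r19 := hf.reg 19 (by decide)
    have a3 := hf.arr 3 (by decide)
    have a5 := hf.arr 5 (by decide)
    have a6 := hf.arr 6 (by decide)
    have a7 := hf.arr 7 (by decide)
    simp [State.setReg_reg, State.setReg_arr] at r4 r18 r19 a3 a5 a6 a7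
    simp only [Expr.eval, r4, a3, ← hb] at hlt'
    have hp : s'.reg 20 < b := by
      by_contra h
      simp [h] at hlt'
    set p := s'.reg 20 with hpdef
    obtain ⟨hp0, hpB⟩ := hlt p h2 hp
    have hk : s.reg 18 + s.arr 6 p + s.arr 7 (s.arr 5 p) - s.reg 19 = key p := (hkey p).symm
    simp only [scanBody, wp_seq, wp_assign, wp_store, Expr.eval, Expr.steps, State.setReg_reg,
      State.setReg_arr, State.setArr_reg, ← hpdef, r18, r19, a5, a6, a7, hk,
      reduceIte, Nat.reduceEqDiff]
    intro _
    have hpn : ∀ k < B, p ∉ ls' k := by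
      intro k hk hmem
      rcases (h4 k hk p).1 hmem with h | h
      · exact hnew k hk p h ⟨h2, hp⟩
      · omega
    refine ⟨40 * (b - (p + 1)), ⟨Function.update ls' (key p) (p :: ls' (key p)), ?_, by omega,
      by omega, ?_, ?_, rfl⟩, by omega⟩
    · intro k hk
      simp only [State.setReg_arr, State.setArr_arr]
      by_cases hkk : k = key p
      · subst hkk
        simp [Chain, hp0]
        exact (h1 _ hk).update (hpn _ hk)
      · simp [hkk]
        exact (h1 _ hk).update (hpn _ hk)
    · intro k hk e
      by_cases hkk : k = key p
      · subst hkk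
        simp only [Function.update_self, List.mem_cons, h4 _ hk]
        constructor
        · rintro (h | h | h)
          · subst h
            exact .inr ⟨h2, by omega, rfl⟩
          · exact .inl h
          · exact .inr ⟨h.1, by omega, h.2.2⟩
        · rintro (h | ⟨h, h', h''⟩)
          · exact .inr (.inl h)
          · by_cases hep : e = p
            · exact .inl hep
            · exact .inr (.inr ⟨h, by omega, h''⟩)
      · rw [Function.update_of_ne hkk, h4 _ hk]
        constructor
        · rintro (h | h)
          · exact .inl h
          · exact .inr ⟨h.1, by omega, h.2.2⟩
        · rintro (h | ⟨h, h', h''⟩)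
          · exact .inl h
          · refine .inr ⟨h, ?_, h''⟩
            have : e ≠ p := by
              rintro rfl
              exact hkk h''
            omega
    · have := queued_update (ls := ls') hpB (p :: ls' (key p))
      simp only [List.length_cons] at this
      omega
  · rintro s' m t hf ⟨ls', h1, h2, h3, h4, h5, h6⟩ hlt' ht
    have r4 := hf.reg 4 (by decide)
    have a3 := hf.arr 3 (by decide)
    simp [State.setReg_reg, State.setReg_arr] at r4 a3
    simp only [Expr.eval, r4, a3, ← hb, Expr.steps] at hlt' ht
    have hp : s'.reg 20 = b := by
      by_contra h
      have : s'.reg 20 < b := by omega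
      simp [this] at hlt'
    rw [hp] at h4 h5
    exact ⟨ls', h1, h4, h5, by omega⟩

theorem clear_spec {s : State} :
    wp clear s (fun s' t => (∀ k < s.reg 11, s'.arr 10 k = 0 ∧ s'.arr 13 k = 0) ∧
      t ≤ 20 * s.reg 11 + 20) := by
  simp only [clear, wp_seq, wp_assign, Expr.eval, Expr.steps]
  refine wp_loop (fun s' m => s'.reg 21 ≤ s.reg 11 ∧
      (∀ k < s'.reg 21, s'.arr 10 k = 0 ∧ s'.arr 13 k = 0) ∧ m = 20 * (s.reg 11 - s'.reg 21))
      (20 * s.reg 11) ?_ ?_ ?_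
  · simp [State.setReg_reg]
  · rintro s' m hf ⟨h1, h2, h3⟩ hlt'
    have r11 := hf.reg 11 (by decide)
    simp [State.setReg_reg] at r11
    simp [Expr.eval, r11] at hlt'
    simp only [wp_seq, wp_assign, wp_store, Expr.eval, Expr.steps, State.setReg_reg,
      State.setReg_arr, State.setArr_reg, State.setArr_arr, reduceIte, Nat.reduceEqDiff]
    intro _
    refine ⟨_, ⟨by omega, fun k hk => ?_, rfl⟩, by omega⟩
    by_cases hkk : k = s'.reg 21
    · simp [hkk]
    · simp [Function.update_of_ne hkk, h2 k (by omega)]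
  · rintro s' m t hf ⟨h1, h2, h3⟩ hlt' ht
    have r11 := hf.reg 11 (by decide)
    simp [State.setReg_reg] at r11
    simp [Expr.eval, r11, Expr.steps] at hlt' ht
    exact ⟨fun k hk => h2 k (by omega), by omega⟩

theorem reprice_spec {s : State} :
    wp reprice s (fun s' t => (∀ k < s.reg 0, s'.arr 7 k =
        if s.arr 13 k = 0 then s.arr 7 k else s.arr 7 k + (s.reg 13 - s.arr 14 k)) ∧
      t ≤ 30 * s.reg 0 + 20) := by
  simp only [reprice, wp_seq, wp_assign, Expr.eval, Expr.steps]
  refine wp_loop (fun s' m => s'.reg 21 ≤ s.reg 0 ∧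
      (∀ k, s'.arr 7 k = if s'.reg 21 ≤ k ∨ s.arr 13 k = 0 then s.arr 7 k
        else s.arr 7 k + (s.reg 13 - s.arr 14 k)) ∧ m = 30 * (s.reg 0 - s'.reg 21))
      (30 * s.reg 0) ?_ ?_ ?_
  · simp [State.setReg_reg, State.setReg_arr]
  · rintro s' m hf ⟨h1, h2, h3⟩ hlt'
    have r0 := hf.reg 0 (by decide)
    have r13 := hf.reg 13 (by decide)
    have a13 := hf.arr 13 (by decide)
    have a14 := hf.arr 14 (by decide)
    simp [State.setReg_reg, State.setReg_arr] at r0 r13 a13 a14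
    simp [Expr.eval, r0] at hlt'
    simp only [wp_seq, wp_assign, wp_store, wp_cond, wp_skip, Expr.eval, Expr.steps, State.setReg_reg,
      State.setReg_arr, State.setArr_reg, State.setArr_arr, a13, a14, r13, reduceIte]
    constructor
    · intro hs _
      refine ⟨_, ⟨by omega, fun k => ?_, rfl⟩, by omega⟩
      by_cases hkk : k = s'.reg 21
      · subst hkk
        simp [hs, h2]
      · rw [Function.update_of_ne hkk, h2]
        have : s'.reg 21 ≤ k ↔ s'.reg 21 + 1 ≤ k := by omega
        simp [this]
    · intro hs _
      refine ⟨_, ⟨by omega, fun k => ?_, rfl⟩, by omega⟩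
      by_cases hkk : k = s'.reg 21
      · subst hkk
        simp [hs, h2]
      · have : s'.reg 21 ≤ k ↔ s'.reg 21 + 1 ≤ k := by omega
        simp [h2, this]
  · rintro s' m t hf ⟨h1, h2, h3⟩ hlt' ht
    have r0 := hf.reg 0 (by decide)
    simp [State.setReg_reg] at r0
    simp [Expr.eval, r0, Expr.steps] at hlt' ht
    refine ⟨fun k hk => ?_, by omega⟩
    rw [h2]
    have : ¬ s'.reg 21 ≤ k := by omega
    simp [this]

end RAM

/-! ### Matchings in lists of edges -/

/-- A bipartite graph with `M` rows, `M` columns, and costs at most `n`, as a list of the edges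
`1, …, E - 1`, sorted by rows. -/
structure EdgeList where
  /-- The number of rows. -/
  M : ℕ
  /-- A bound for the costs. -/
  n : ℕ
  /-- The first number that is not an edge. -/
  E : ℕ
  /-- The first edge of a row. -/
  start : ℕ → ℕ
  /-- The row of an edge. -/
  row : ℕ → ℕ
  /-- The column of an edge. -/
  col : ℕ → ℕ
  /-- The cost of an edge. -/
  cost : ℕ → ℕ

namespace EdgeList

/-- The number `e` is an edge. -/
def Valid (g : EdgeList) (e : ℕ) : Prop := 1 ≤ e ∧ e < g.E

/-- The edges are sorted by rows, and the rows, columns and costs are in range. -/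
structure WF (g : EdgeList) : Prop where
  start_zero : g.start 0 = 1
  start_last : g.start g.M = g.E
  start_mono : ∀ i < g.M, g.start i ≤ g.start (i + 1)
  mem_row : ∀ i < g.M, ∀ e, g.start i ≤ e → e < g.start (i + 1) → g.Valid e ∧ g.row e = i
  row_lt : ∀ e, g.Valid e → g.row e < g.M
  start_le : ∀ e, g.Valid e → g.start (g.row e) ≤ e
  lt_start : ∀ e, g.Valid e → e < g.start (g.row e + 1)
  col_lt : ∀ e, g.Valid e → g.col e < g.M
  cost_le : ∀ e, g.Valid e → g.cost e ≤ g.n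

/-- The number of edges in a row. -/
def deg (g : EdgeList) (i : ℕ) : ℕ := g.start (i + 1) - g.start i

/-- `mate` and `rmate` give the edges of a matching of the first `r` rows. -/
structure IsMatching (g : EdgeList) (r : ℕ) (mate rmate : ℕ → ℕ) : Prop where
  left : ∀ i < r, g.Valid (rmate i) ∧ g.row (rmate i) = i ∧ mate (g.col (rmate i)) = rmate i
  right : ∀ j < g.M, mate j ≠ 0 → g.Valid (mate j) ∧ g.col (mate j) = j ∧
    g.row (mate j) < r ∧ rmate (g.row (mate j)) = mate j

/-- At the prices `w`, the edge `e` is a cheapest one in its row. -/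
def Tight (g : EdgeList) (w : ℕ → ℕ) (e : ℕ) : Prop :=
  ∀ f, g.Valid f → g.row f = g.row e → g.cost e + w (g.col e) ≤ g.cost f + w (g.col f)

/-- The prices `w` support the matching. -/
structure Supports (g : EdgeList) (w mate : ℕ → ℕ) : Prop where
  tight : ∀ j < g.M, mate j ≠ 0 → g.Tight w (mate j)
  free : ∀ j < g.M, mate j = 0 → w j = 0
  le : ∀ j < g.M, w j ≤ 2 * (g.n * g.M)

/-- The edge `e` leaves the row `r`, or the row matched to a column with a stamp below `t`, and `k`
is the length of the path through `e` in the tree of shortest paths. -/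
def Key (g : EdgeList) (r : ℕ) (w mate stamp dist : ℕ → ℕ) (t e k : ℕ) : Prop :=
  (g.row e = r ∧ k = g.cost e + w (g.col e)) ∨
  ∃ j < g.M, 0 < stamp j ∧ stamp j < t ∧ mate j ≠ 0 ∧ g.row (mate j) = g.row e ∧
    k + (g.cost (mate j) + w j) = dist j + (g.cost e + w (g.col e))

/-- The columns with non-zero stamps form a tree of shortest paths up to the length `d`. -/
structure Tree (g : EdgeList) (r : ℕ) (w mate stamp dist par : ℕ → ℕ) (cnt d : ℕ) : Prop where
  card : cnt = ((Finset.range g.M).filter (fun j => stamp j ≠ 0)).card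
  stamp_le : ∀ j < g.M, stamp j ≤ cnt
  dist_le : ∀ j < g.M, stamp j ≠ 0 → dist j ≤ d
  dist_le_add : ∀ j < g.M, stamp j ≠ 0 → dist j ≤ w j + cnt * g.n
  le_dist_add : ∀ j < g.M, stamp j ≠ 0 → w j ≤ dist j + cnt * g.n
  par : ∀ j < g.M, stamp j ≠ 0 → g.Valid (par j) ∧ g.col (par j) = j ∧
    g.Key r w mate stamp dist (stamp j) (par j) (dist j)

/-- The buckets hold the edges that leave the tree. -/
structure Queue (g : EdgeList) (r : ℕ) (w mate stamp dist : ℕ → ℕ) (cnt d B : ℕ)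
    (ls : ℕ → List ℕ) : Prop where
  mem : ∀ k < B, ∀ e ∈ ls k, g.Valid e ∧ g.Key r w mate stamp dist (cnt + 1) e k ∧ d ≤ k
  done : ∀ e k, g.Valid e → g.Key r w mate stamp dist (cnt + 1) e k →
    (k < B ∧ e ∈ ls k ∧ d ≤ k) ∨ (stamp (g.col e) ≠ 0 ∧ dist (g.col e) ≤ k)

variable {g : EdgeList} {r : ℕ} {w mate rmate stamp dist par : ℕ → ℕ} {cnt d : ℕ}

theorem WF.sum_deg (hg : g.WF) : ∑ i ∈ Finset.range g.M, g.deg i + 1 = g.E := by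
  have H : ∀ m ≤ g.M, ∑ i ∈ Finset.range m, g.deg i + 1 = g.start m := by
    intro m
    induction m with
    | zero => simp [hg.start_zero]
    | succ m ih =>
      intro hm
      have h1 := ih (by omega)
      have h2 := hg.start_mono m (by omega)
      rw [Finset.sum_range_succ, deg]
      omega
  rw [H g.M le_rfl, hg.start_last]

theorem IsMatching.row_inj (hm : g.IsMatching r mate rmate) {j j' : ℕ} (hj : j < g.M)
    (hj' : j' < g.M) (h : mate j ≠ 0) (h' : mate j' ≠ 0)
    (hr : g.row (mate j) = g.row (mate j')) : j = j' := by
  obtain ⟨-, h1, -, h2⟩ := hm.right j hj h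
  obtain ⟨-, h1', -, h2'⟩ := hm.right j' hj' h'
  rw [← h1, ← h1', ← h2, ← h2', hr]

/-- Distinct matched columns belong to distinct rows, so the rows opened during one search are
scanned at most once each; the search is linear in the number of edges. -/
theorem IsMatching.sum_deg_le (hg : g.WF) (hm : g.IsMatching r mate rmate) (hr : r ≤ g.M) :
    ∑ j ∈ Finset.range g.M, (if mate j = 0 then 0 else g.deg (g.row (mate j))) ≤ g.E := by
  have h1 : ∑ j ∈ Finset.range g.M, (if mate j = 0 then 0 else g.deg (g.row (mate j))) =
      ∑ j ∈ (Finset.range g.M).filter (fun j => mate j ≠ 0), g.deg (g.row (mate j)) := by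
    rw [Finset.sum_filter]
    refine Finset.sum_congr rfl fun j _ => ?_
    by_cases h : mate j = 0 <;> simp [h]
  rw [h1, ← hg.sum_deg]
  have h2 : ∑ j ∈ (Finset.range g.M).filter (fun j => mate j ≠ 0), g.deg (g.row (mate j)) =
      ∑ i ∈ ((Finset.range g.M).filter (fun j => mate j ≠ 0)).image (fun j => g.row (mate j)),
        g.deg i := by
    rw [Finset.sum_image]
    intro j hj j' hj' h
    simp only [Finset.coe_filter, Finset.mem_range, Set.mem_ofPred_eq] at hj hj'
    exact hm.row_inj hj.1 hj'.1 hj.2 hj'.2 h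
  rw [h2]
  refine (Finset.sum_le_sum_of_subset ?_).trans (Nat.le_succ _)
  intro i hi
  simp only [Finset.mem_image, Finset.mem_filter, Finset.mem_range] at hi ⊢
  obtain ⟨j, ⟨hj, hj'⟩, rfl⟩ := hi
  have := (hm.right j hj hj').2.2.1
  omega

theorem Tree.cnt_le (ht : g.Tree r w mate stamp dist par cnt d) : cnt ≤ g.M := by
  rw [ht.card]
  exact (Finset.card_filter_le _ _).trans (by simp)

/-- The length at the last visited column exceeds its price by at most `n * M`, and this price
cancels against the matched edge. The next edge adds at most `n` plus a price of at most `2 * (n *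
M)`. Hence `4 * (n * M) + 1` buckets suffice. -/
theorem Tree.key_le (hg : g.WF) (hw : g.Supports w mate)
    (ht : g.Tree r w mate stamp dist par cnt d) {e k t : ℕ} (he : g.Valid e)
    (hk : g.Key r w mate stamp dist t e k) : k ≤ 4 * (g.n * g.M) := by
  have h1 := hg.cost_le e he
  have h2 := hw.le _ (hg.col_lt e he)
  have h3 := hg.col_lt e he
  have h4 : g.n ≤ g.n * g.M := Nat.le_mul_of_pos_right _ (by omega)
  rcases hk with ⟨-, rfl⟩ | ⟨j, hj, hs, -, hmj, -, h⟩
  · omega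
  · have h5 := ht.dist_le_add j hj (by omega)
    have h6 : cnt * g.n ≤ g.n * g.M := by
      rw [mul_comm]
      exact Nat.mul_le_mul_left _ ht.cnt_le
    omega

/-- Visiting a new column at the end of a shortest path. -/
theorem Tree.visit (hg : g.WF) (hm : g.IsMatching r mate rmate)
    (ht : g.Tree r w mate stamp dist par cnt d) {e j : ℕ} (he : g.Valid e) (hj : g.col e = j)
    (hk : g.Key r w mate stamp dist (cnt + 1) e d) (hs : stamp j = 0) :
    g.Tree r w mate (Function.update stamp j (cnt + 1)) (Function.update dist j d)
      (Function.update par j e) (cnt + 1) d := by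
  have hjM : j < g.M := hj ▸ hg.col_lt e he
  -- Existing keys pass only through columns with nonzero stamps, hence not through `j`.
  have hmono : ∀ t e' k, g.Key r w mate stamp dist t e' k →
      g.Key r w mate (Function.update stamp j (cnt + 1)) (Function.update dist j d) t e' k := by
    rintro t e' k (h | ⟨j', h1, h2, h3⟩)
    · exact .inl h
    · have hne : j' ≠ j := by
        rintro rfl
        omega
      refine .inr ⟨j', h1, ?_⟩
      rw [Function.update_of_ne hne, Function.update_of_ne hne]
      exact ⟨h2, h3⟩
  have hn : (cnt + 1) * g.n = cnt * g.n + g.n := by ring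
  constructor
  · rw [ht.card]
    have : (Finset.range g.M).filter (fun i => Function.update stamp j
        (((Finset.range g.M).filter (fun j => stamp j ≠ 0)).card + 1) i ≠ 0) =
        insert j ((Finset.range g.M).filter (fun j => stamp j ≠ 0)) := by
      ext i
      by_cases hi : i = j
      · simp [hi, hjM]
      · simp [hi]
    rw [this, Finset.card_insert_of_notMem (by simp [hs])]
  · intro i hi
    by_cases hij : i = j
    · simp [hij]
    · rw [Function.update_of_ne hij]
      have := ht.stamp_le i hi
      omega
  · intro i hi his
    by_cases hij : i = j
    · simp [hij]
    · rw [Function.update_of_ne hij] at his ⊢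
      exact ht.dist_le i hi his
  -- Prices telescope along the path, so length minus price changes by at most `n` with each new
  -- column: upwards by the cost of the new edge, downwards by that of a matched edge.
  · intro i hi his
    by_cases hij : i = j
    · subst hij
      rw [Function.update_self]
      have h1 := hg.cost_le e he
      rcases hk with ⟨-, h⟩ | ⟨j', h2, h3, -, -, -, h4⟩
      · rw [hj] at h
        omega
      · rw [hj] at h4
        have := ht.dist_le_add j' h2 (by omega)
        omega
    · rw [Function.update_of_ne hij] at his ⊢
      have := ht.dist_le_add i hi his
      omega
  · intro i hi his
    by_cases hij : i = j
    · subst hij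
      rw [Function.update_self]
      rcases hk with ⟨-, h⟩ | ⟨j', h2, h3, -, h5, -, h4⟩
      · rw [hj] at h
        omega
      · rw [hj] at h4
        have := ht.le_dist_add j' h2 (by omega)
        have := hg.cost_le _ (hm.right j' h2 h5).1
        omega
    · rw [Function.update_of_ne hij] at his ⊢
      have := ht.le_dist_add i hi his
      omega
  · intro i hi his
    by_cases hij : i = j
    · subst hij
      simp only [Function.update_self]
      exact ⟨he, hj, hmono _ _ _ hk⟩
    · simp only [Function.update_of_ne hij] at his ⊢
      obtain ⟨h1, h2, h3⟩ := ht.par i hi his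
      exact ⟨h1, h2, hmono _ _ _ h3⟩

/-- Keys after the visit of a new column: either old, or through the new column. -/
theorem key_visit_iff {j t e k : ℕ} (hjM : j < g.M) (hs : stamp j = 0)
    (hle : ∀ j < g.M, stamp j ≤ cnt) (ht : t = cnt + 1) :
    g.Key r w mate (Function.update stamp j (cnt + 1)) (Function.update dist j d) (t + 1) e k ↔
      g.Key r w mate stamp dist t e k ∨ (mate j ≠ 0 ∧ g.row (mate j) = g.row e ∧
        k + (g.cost (mate j) + w j) = d + (g.cost e + w (g.col e))) := by
  subst ht
  constructor
  · rintro (h | ⟨j', h1, h2, h3, h4⟩)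
    · exact .inl (.inl h)
    · by_cases hij : j' = j
      · subst hij
        simp only [Function.update_self] at h4
        exact .inr h4
      · simp only [Function.update_of_ne hij] at h2 h3 h4
        have := hle j' h1
        exact .inl (.inr ⟨j', h1, h2, by omega, h4⟩)
  · rintro ((h | ⟨j', h1, h2, h3, h4⟩) | h)
    · exact .inl h
    · have hij : j' ≠ j := by
        rintro rfl
        omega
      refine .inr ⟨j', h1, ?_⟩
      simp only [Function.update_of_ne hij]
      exact ⟨h2, by omega, h4⟩
    · refine .inr ⟨j, hjM, ?_⟩
      simp only [Function.update_self]
      exact ⟨by omega, by omega, h⟩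

/-- A shortest path to the free column `j`, of length `d`, has been found. -/
structure Found (g : EdgeList) (r : ℕ) (w mate stamp dist par : ℕ → ℕ) (cnt d j : ℕ) : Prop where
  tree : g.Tree r w mate stamp dist par cnt d
  lt : j < g.M
  stamp_ne : stamp j ≠ 0
  dist_eq : dist j = d
  free : mate j = 0
  uniq : ∀ i < g.M, stamp i ≠ 0 → mate i = 0 → i = j
  reach : ∀ e k, g.Valid e → g.Key r w mate stamp dist (cnt + 1) e k →
    d ≤ k ∨ (stamp (g.col e) ≠ 0 ∧ dist (g.col e) ≤ k)

/-- The prices after the search. -/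
def newPrice (w stamp dist : ℕ → ℕ) (d j : ℕ) : ℕ :=
  if stamp j = 0 then w j else w j + (d - dist j)

theorem le_newPrice (j : ℕ) : w j ≤ newPrice w stamp dist d j := by
  unfold newPrice
  split_ifs <;> omega

/-- No price falls, so an edge matched to an unvisited column stays cheapest. For a visited column,
take another edge of its row and its key `k`. If `k` is at least `d`, its reduced cost absorbs the
raise `d - dist i`. Otherwise its column is visited at a length of at most `k`, and is itself raised
by enough. -/
theorem Found.tight_mate {j : ℕ} (hm : g.IsMatching r mate rmate)
    (hw : g.Supports w mate) (hf : g.Found r w mate stamp dist par cnt d j) {i : ℕ}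
    (hi : i < g.M) (hmi : mate i ≠ 0) : g.Tight (newPrice w stamp dist d) (mate i) := by
  intro e' he' hr
  obtain ⟨hv, hc, -, -⟩ := hm.right i hi hmi
  have h1 := hw.tight i hi hmi e' he' hr
  have h2 : w (g.col e') ≤ newPrice w stamp dist d (g.col e') := le_newPrice _
  rw [hc] at h1 ⊢
  by_cases hs : stamp i = 0
  · rw [newPrice, if_pos hs]
    omega
  · have h3 : newPrice w stamp dist d i = w i + (d - dist i) := if_neg hs
    have h4 := hf.tree.dist_le i hi hs
    have h5 := hf.tree.stamp_le i hi
    rcases hf.reach e' (dist i + (g.cost e' + w (g.col e')) - (g.cost (mate i) + w i)) he'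
      (.inr ⟨i, hi, by omega, by omega, hmi, hr.symm, by omega⟩) with h | ⟨h, h'⟩
    · omega
    · have h6 : newPrice w stamp dist d (g.col e') =
        w (g.col e') + (d - dist (g.col e')) := if_neg h
      omega

/-- A parent edge in the row `r` is handled by `reach`. Any other parent edge has, at the new
prices, the same cost plus price as the matched edge of its row, so it inherits tightness from
`tight_mate`. These are the edges that the augmentation inserts. -/
theorem Found.tight_par {j : ℕ} (hm : g.IsMatching r mate rmate)
    (hw : g.Supports w mate) (hf : g.Found r w mate stamp dist par cnt d j) {i : ℕ}
    (hi : i < g.M) (hs : stamp i ≠ 0) : g.Tight (newPrice w stamp dist d) (par i) := by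
  intro e' he' hr
  obtain ⟨hv, hc, hk⟩ := hf.tree.par i hi hs
  have h2 : w (g.col e') ≤ newPrice w stamp dist d (g.col e') := le_newPrice _
  have h3 : newPrice w stamp dist d i = w i + (d - dist i) := if_neg hs
  have h4 := hf.tree.dist_le i hi hs
  rw [hc]
  rcases hk with ⟨h5, h6⟩ | ⟨j', h5, h6, h7, h8, h9, h10⟩
  · rw [hc] at h6
    rcases hf.reach e' _ he' (.inl ⟨hr.trans h5, rfl⟩) with h | ⟨h, h'⟩
    · omega
    · have h6 : newPrice w stamp dist d (g.col e') =
        w (g.col e') + (d - dist (g.col e')) := if_neg h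
      omega
  · rw [hc] at h10
    have h11 := hf.tight_mate hm hw h5 h8 e' he' (hr.trans h9.symm)
    rw [(hm.right j' h5 h8).2.1] at h11
    have h12 : newPrice w stamp dist d j' = w j' + (d - dist j') := if_neg (by omega)
    have h13 := hf.tree.dist_le j' h5 (by omega)
    omega

/-- The path ends in a free column, whose price is zero, so `d` is at most `cnt * n`; also `w i -
dist i` is at most `cnt * n`. A raised price is thus at most `2 * cnt * n`, whatever the stage: the
bound does not accumulate. -/
theorem Found.newPrice_le {j : ℕ} (hw : g.Supports w mate)
    (hf : g.Found r w mate stamp dist par cnt d j) {i : ℕ} (hi : i < g.M) :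
    newPrice w stamp dist d i ≤ 2 * (g.n * g.M) := by
  unfold newPrice
  split_ifs with hs
  · exact hw.le i hi
  · have h1 := hf.tree.le_dist_add i hi hs
    have h2 := hf.tree.dist_le_add j hf.lt hf.stamp_ne
    have h3 := hf.tree.dist_le i hi hs
    rw [hf.dist_eq, hw.free j hf.lt hf.free] at h2
    have h6 : cnt * g.n ≤ g.n * g.M := by
      rw [mul_comm]
      exact Nat.mul_le_mul_left _ hf.tree.cnt_le
    omega

/-- The only free column visited is the target, and its raise `d - dist j` vanishes. -/
theorem Found.newPrice_free {j : ℕ} (hw : g.Supports w mate)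
    (hf : g.Found r w mate stamp dist par cnt d j) {i : ℕ} (hi : i < g.M) (hmi : mate i = 0) :
    newPrice w stamp dist d i = 0 := by
  unfold newPrice
  split_ifs with hs
  · exact hw.free i hi hmi
  · rw [hf.uniq i hi hs hmi, hf.dist_eq, hw.free j hf.lt hf.free]
    simp

/-- If the search ends without finding a free column, then Hall's condition fails. -/
theorem Tree.not_perfect (hg : g.WF) (hm : g.IsMatching r mate rmate) (hw : g.Supports w mate)
    (hr : r < g.M) (ht : g.Tree r w mate stamp dist par cnt d)
    (hmat : ∀ j < g.M, stamp j ≠ 0 → mate j ≠ 0)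
    (hclosed : ∀ e k, g.Valid e → g.Key r w mate stamp dist (cnt + 1) e k → stamp (g.col e) ≠ 0)
    (f : ℕ → ℕ) (hf : Set.InjOn f (Set.Iio g.M)) :
    ¬ ∀ i < g.M, ∃ e, g.Valid e ∧ g.row e = i ∧ g.col e = f i := by
  intro hex
  set V := (Finset.range g.M).filter (fun j => stamp j ≠ 0) with hV
  have memV : ∀ j, j ∈ V ↔ j < g.M ∧ stamp j ≠ 0 := by simp [hV]
  -- The Hall violator: one more row than there are visited columns, while every edge out of these
  -- rows ends in a visited column.
  set S := insert r (V.image (fun j => g.row (mate j))) with hS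
  have hSM : ∀ i ∈ S, i < g.M := by
    intro i hi
    simp only [hS, Finset.mem_insert, Finset.mem_image, memV] at hi
    rcases hi with rfl | ⟨j, ⟨h1, h2⟩, rfl⟩
    · exact hr
    · have := (hm.right j h1 (hmat j h1 h2)).2.2.1
      omega
  have hcard : S.card = V.card + 1 := by
    rw [hS, Finset.card_insert_of_notMem, Finset.card_image_of_injOn]
    · intro j hj j' hj' h
      rw [Finset.mem_coe, memV] at hj hj'
      exact hm.row_inj hj.1 hj'.1 (hmat _ hj.1 hj.2) (hmat _ hj'.1 hj'.2) h
    · simp only [Finset.mem_image, memV, not_exists, not_and, and_imp]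
      intro j h1 h2 h3
      have := (hm.right j h1 (hmat j h1 h2)).2.2.1
      omega
  have hmaps : ∀ i ∈ S, f i ∈ V := by
    intro i hi
    obtain ⟨e, he, hre, hce⟩ := hex i (hSM i hi)
    rw [memV, ← hce]
    refine ⟨hg.col_lt e he, ?_⟩
    simp only [hS, Finset.mem_insert, Finset.mem_image, memV] at hi
    rcases hi with rfl | ⟨j, ⟨h1, h2⟩, h3⟩
    · exact hclosed e _ he (.inl ⟨hre, rfl⟩)
    · have h4 := hmat j h1 h2
      -- Tightness makes the truncated subtraction in the key below exact.
      have h5 := hw.tight j h1 h4 e he (by rw [hre, h3])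
      rw [(hm.right j h1 h4).2.1] at h5
      have h6 := ht.stamp_le j h1
      exact hclosed e (dist j + (g.cost e + w (g.col e)) - (g.cost (mate j) + w j)) he
        (.inr ⟨j, h1, by omega, by omega, h4, by rw [hre, h3], by omega⟩)
  have := Finset.card_le_card_of_injOn f hmaps
    (fun i hi j hj h => hf (hSM i hi) (hSM j hj) h)
  omega

/-! ### The queue of the search -/

section Queue

variable {B : ℕ} {ls : ℕ → List ℕ}

theorem Queue.advance (hq : g.Queue r w mate stamp dist cnt d B ls)
    (h : ls d = []) : g.Queue r w mate stamp dist cnt (d + 1) B ls := by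
  constructor
  · intro k hk e he
    obtain ⟨h1, h2, h3⟩ := hq.mem k hk e he
    refine ⟨h1, h2, ?_⟩
    have : d ≠ k := by
      rintro rfl
      simp [h] at he
    omega
  · intro e k he hk
    rcases hq.done e k he hk with ⟨h1, h2, h3⟩ | h1
    · refine .inl ⟨h1, h2, ?_⟩
      have : d ≠ k := by
        rintro rfl
        simp [h] at h2
      omega
    · exact .inr h1

theorem mem_of_mem_pop {e e' k : ℕ} {l : List ℕ} (h : ls d = e :: l)
    (hmem : e' ∈ Function.update ls d l k) : e' ∈ ls k := by
  by_cases hk : k = d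
  · subst hk
    rw [Function.update_self] at hmem
    rw [h]
    exact List.mem_cons_of_mem _ hmem
  · rwa [Function.update_of_ne hk] at hmem

theorem mem_pop {e e' k : ℕ} {l : List ℕ} (h : ls d = e :: l) (hne : e' ≠ e)
    (hmem : e' ∈ ls k) : e' ∈ Function.update ls d l k := by
  by_cases hk : k = d
  · subst hk
    rw [Function.update_self]
    rw [h] at hmem
    exact (List.mem_cons.1 hmem).resolve_left hne
  · rwa [Function.update_of_ne hk]

/-- The discarded edge stays accounted for: its column was reached earlier by a path that is no
longer. -/
theorem Queue.pop_visited (hq : g.Queue r w mate stamp dist cnt d B ls) {e : ℕ} {l : List ℕ}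
    (h : ls d = e :: l) (hs : stamp (g.col e) ≠ 0) (hdist : dist (g.col e) ≤ d) :
    g.Queue r w mate stamp dist cnt d B (Function.update ls d l) := by
  constructor
  · exact fun k hk e' he' => hq.mem k hk e' (mem_of_mem_pop h he')
  · intro e' k he' hk
    rcases hq.done e' k he' hk with ⟨h1, h2, h3⟩ | h1
    · by_cases hee : e' = e
      · subst hee
        exact .inr ⟨hs, hdist.trans h3⟩
      · exact .inl ⟨h1, mem_pop h hee h2, h3⟩
    · exact .inr h1

/-- A free column opens no row, so the visit creates no new keys; all edges still queued have keys
of at least `d`, as in Dijkstra's algorithm. -/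
theorem Queue.found (hg : g.WF) (hm : g.IsMatching r mate rmate)
    (ht : g.Tree r w mate stamp dist par cnt d) (hq : g.Queue r w mate stamp dist cnt d B ls)
    (hmat : ∀ j < g.M, stamp j ≠ 0 → mate j ≠ 0) (hd : d < B) {e j : ℕ} {l : List ℕ}
    (h : ls d = e :: l) (hj : g.col e = j) (hs : stamp j = 0) (hfree : mate j = 0) :
    g.Found r w mate (Function.update stamp j (cnt + 1)) (Function.update dist j d)
      (Function.update par j e) (cnt + 1) d j := by
  obtain ⟨he, hk, -⟩ := hq.mem d hd e (by simp [h])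
  have hjM : j < g.M := hj ▸ hg.col_lt e he
  refine ⟨ht.visit hg hm he hj hk hs, hjM, by simp, by simp, hfree, ?_, ?_⟩
  · intro i hi his hmi
    by_contra hij
    rw [Function.update_of_ne hij] at his
    exact hmat i hi his hmi
  · intro e' k he' hk'
    rw [key_visit_iff hjM hs ht.stamp_le rfl] at hk'
    rcases hk' with hk' | hk'
    · rcases hq.done e' k he' hk' with ⟨h1, h2, h3⟩ | ⟨h1, h2⟩
      · exact .inl h3
      · have hne : g.col e' ≠ j := by
          rintro h'
          rw [h'] at h1
          exact h1 hs
        rw [Function.update_of_ne hne, Function.update_of_ne hne]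
        exact .inr ⟨h1, h2⟩
    · exact absurd hfree hk'.1

/-- A queued edge leaves the row `r` or a row matched to a visited column. The row of `mate j` is
neither: it precedes `r`, and its column is unvisited. This provides `hnew` for `scan_spec`. -/
theorem Queue.not_mem_row (hg : g.WF) (hm : g.IsMatching r mate rmate) (hr : r < g.M)
    (hq : g.Queue r w mate stamp dist cnt d B ls) {j : ℕ} (hjM : j < g.M) (hs : stamp j = 0)
    (hmj : mate j ≠ 0) {k e' : ℕ} (hk : k < B) (he' : e' ∈ ls k) :
    ¬ (g.start (g.row (mate j)) ≤ e' ∧ e' < g.start (g.row (mate j) + 1)) := by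
  rintro ⟨h1, h2⟩
  have h3 := (hm.right j hjM hmj).2.2.1
  obtain ⟨h4, h5⟩ := hg.mem_row _ (by omega) e' h1 h2
  obtain ⟨-, h | ⟨j', h6, h7, h8, h9, h10, -⟩, -⟩ := hq.mem k hk e' he'
  · omega
  · have := hm.row_inj h6 hjM h9 hmj (h10.trans h5)
    subst this
    omega

/-- Dijkstra's step. Tightness of `mate j` makes the reduced costs in its row nonnegative, so no new
key falls below `d`, and `Tree.key_le` guarantees a bucket for each. -/
theorem Queue.visit (hg : g.WF) (hm : g.IsMatching r mate rmate) (hw : g.Supports w mate)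
    (hr : r < g.M) (ht : g.Tree r w mate stamp dist par cnt d) (hB : B = 4 * (g.n * g.M) + 1)
    (hq : g.Queue r w mate stamp dist cnt d B ls) (hd : d < B) {e j : ℕ} {l : List ℕ}
    (h : ls d = e :: l) (hj : g.col e = j) (hs : stamp j = 0) (hmj : mate j ≠ 0)
    {ls' : ℕ → List ℕ} (hls' : ∀ k < B, ∀ e', e' ∈ ls' k ↔ e' ∈ Function.update ls d l k ∨
      (g.start (g.row (mate j)) ≤ e' ∧ e' < g.start (g.row (mate j) + 1) ∧
        k = d + g.cost e' + w (g.col e') - (g.cost (mate j) + w j))) :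
    g.Queue r w mate (Function.update stamp j (cnt + 1)) (Function.update dist j d)
      (cnt + 1) d B ls' := by
  obtain ⟨he, hk, -⟩ := hq.mem d hd e (by simp [h])
  have hjM : j < g.M := hj ▸ hg.col_lt e he
  obtain ⟨-, hcm, hrm, -⟩ := hm.right j hjM hmj
  have ht' := ht.visit hg hm he hj hk hs
  constructor
  · intro k hk e' he'
    rw [key_visit_iff hjM hs ht.stamp_le rfl]
    rcases (hls' k hk e').1 he' with h1 | ⟨h1, h2, h3⟩
    · obtain ⟨h4, h5, h6⟩ := hq.mem k hk e' (mem_of_mem_pop h h1)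
      exact ⟨h4, .inl h5, h6⟩
    · obtain ⟨h4, h5⟩ := hg.mem_row _ (by omega) e' h1 h2
      have h6 := hw.tight j hjM hmj e' h4 h5
      rw [hcm] at h6
      exact ⟨h4, .inr ⟨hmj, h5.symm, by omega⟩, by omega⟩
  · intro e' k he' hk'
    have hkB := ht'.key_le hg hw he' hk'
    rw [key_visit_iff hjM hs ht.stamp_le rfl] at hk'
    rcases hk' with hk' | ⟨-, h1, h2⟩
    · rcases hq.done e' k he' hk' with ⟨h1, h2, h3⟩ | ⟨h1, h2⟩
      · by_cases hee : e' = e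
        · subst hee
          right
          simp [hj, h3]
        · exact .inl ⟨h1, (hls' k h1 e').2 (.inl (mem_pop h hee h2)), h3⟩
      · have hne : g.col e' ≠ j := by
          rintro h'
          rw [h'] at h1
          exact h1 hs
        rw [Function.update_of_ne hne, Function.update_of_ne hne]
        exact .inr ⟨h1, h2⟩
    · have h6 := hw.tight j hjM hmj e' he' h1.symm
      rw [hcm] at h6
      refine .inl ⟨by omega, (hls' k (by omega) e').2 (.inr ?_), by omega⟩
      rw [h1]
      exact ⟨hg.start_le e' he', hg.lt_start e' he', by omega⟩

end Queue

end EdgeList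

/-! ### Correctness and amortised cost of the shortest path search -/

namespace RAM

/-- The graph `g` is stored in the state `s`, together with the number of buckets. -/
structure Holds (g : EdgeList) (s : State) : Prop where
  reg0 : s.reg 0 = g.M
  reg11 : s.reg 11 = 4 * (g.n * g.M) + 1
  arr3 : s.arr 3 = g.start
  arr4 : s.arr 4 = g.row
  arr5 : s.arr 5 = g.col
  arr6 : s.arr 6 = g.cost

/-- A bound for the time needed for the columns that are still to be visited. -/
def unvisited (g : EdgeList) (mate stamp : ℕ → ℕ) : ℕ :=
  ∑ j ∈ Finset.range g.M, if stamp j = 0 then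
    100 + 100 * (if mate j = 0 then 0 else g.deg (g.row (mate j))) else 0

/-- The potential released by a visit: for each edge of the opened row, 40 steps for the scan and 60
for its later removal from a bucket, plus a fixed overhead of 100. -/
theorem unvisited_update {g : EdgeList} {mate stamp : ℕ → ℕ} {j c : ℕ} (hj : j < g.M)
    (hs : stamp j = 0) :
    unvisited g mate (Function.update stamp j (c + 1)) +
      (100 + 100 * (if mate j = 0 then 0 else g.deg (g.row (mate j)))) =
        unvisited g mate stamp := by
  unfold unvisited
  have hj' : j ∈ Finset.range g.M := Finset.mem_range.2 hj
  rw [← Finset.add_sum_erase _ _ hj',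
    ← Finset.add_sum_erase _ (fun j => if stamp j = 0 then
      100 + 100 * (if mate j = 0 then 0 else g.deg (g.row (mate j))) else 0) hj']
  have : ∀ x ∈ (Finset.range g.M).erase j,
      (if Function.update stamp j (c + 1) x = 0 then
        100 + 100 * (if mate x = 0 then 0 else g.deg (g.row (mate x))) else 0) =
      (if stamp x = 0 then
        100 + 100 * (if mate x = 0 then 0 else g.deg (g.row (mate x))) else 0) := by
    intro x hx
    rw [Function.update_of_ne (Finset.ne_of_mem_erase hx)]
  rw [Finset.sum_congr rfl this]
  simp only [Function.update_self, hs, if_true]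
  simp
  omega

theorem unvisited_le {g : EdgeList} {r : ℕ} {mate rmate stamp : ℕ → ℕ} (hg : g.WF)
    (hm : g.IsMatching r mate rmate) (hr : r ≤ g.M) :
    unvisited g mate stamp ≤ 100 * g.M + 100 * g.E := by
  have h1 : unvisited g mate stamp ≤ ∑ j ∈ Finset.range g.M,
      (100 + 100 * (if mate j = 0 then 0 else g.deg (g.row (mate j)))) := by
    refine Finset.sum_le_sum fun j _ => ?_
    split_ifs <;> omega
  rw [Finset.sum_add_distrib, ← Finset.mul_sum] at h1
  have h2 := hm.sum_deg_le hg hr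
  simp only [Finset.sum_const, Finset.card_range, smul_eq_mul] at h1
  omega

/-- The state of the search, with the time `m` still to be spent. -/
def SearchInv (g : EdgeList) (r : ℕ) (w mate : ℕ → ℕ) (s : State) (m : ℕ) : Prop :=
  (s.reg 17 = 1 ∧ s.reg 14 = 0 ∧
    g.Found r w mate (s.arr 13) (s.arr 14) (s.arr 12) (s.reg 16) (s.reg 13) (s.reg 5)) ∨
  (s.reg 17 = 0 ∧ s.reg 14 = (if s.reg 13 < 4 * (g.n * g.M) + 1 then 1 else 0) ∧
    g.Tree r w mate (s.arr 13) (s.arr 14) (s.arr 12) (s.reg 16) (s.reg 13) ∧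
    (∀ j < g.M, s.arr 13 j ≠ 0 → mate j ≠ 0) ∧
    ∃ ls, Buckets (4 * (g.n * g.M) + 1) s ls ∧
      g.Queue r w mate (s.arr 13) (s.arr 14) (s.reg 16) (s.reg 13) (4 * (g.n * g.M) + 1) ls ∧
      20 * (4 * (g.n * g.M) + 1 - s.reg 13) + 60 * queued (4 * (g.n * g.M) + 1) ls +
        unvisited g mate (s.arr 13) ≤ m)

/-- Every pass is paid for by the potential: an empty bucket by the advance of the level, a removed
edge by its share of the queue, a new column by `unvisited_update`. The summand `1` is the loop
test. -/
theorem searchBody_spec {g : EdgeList} {r : ℕ} {w mate rmate : ℕ → ℕ} {s : State} {m : ℕ}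
    (hg : g.WF) (hm : g.IsMatching r mate rmate) (hw : g.Supports w mate) (hr : r < g.M)
    (hs : Holds g s) (h7 : s.arr 7 = w) (h8 : s.arr 8 = mate)
    (hI : SearchInv g r w mate s m) (hrun : s.reg 14 ≠ 0) :
    wp searchBody s (fun s' t => ∃ m', SearchInv g r w mate s' m' ∧ 1 + t + m' ≤ m) := by
  rcases hI with ⟨-, h, -⟩ | ⟨h17, h14, ht, hmat, ls, hb, hq, hpot⟩
  · exact absurd h hrun
  have hd : s.reg 13 < 4 * (g.n * g.M) + 1 := by
    by_contra h
    rw [if_neg h] at h14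
    exact hrun h14
  set B := 4 * (g.n * g.M) + 1 with hB
  set d := s.reg 13 with hdd
  have hbd := hb d hd
  simp only [searchBody, wp_seq, wp_assign, wp_store, wp_cond, wp_skip, Expr.eval, Expr.steps,
    State.setReg_reg, State.setReg_arr, State.setArr_reg, State.setArr_arr, reduceIte,
    Nat.reduceEqDiff, ← hdd]
  refine ⟨fun h0 => ?_, fun h0 => ?_⟩
  · have h0 : s.arr 10 d = 0 := by simpa using h0
    rw [h0] at hbd
    have hnil := hbd.eq_nil
    refine ⟨20 * (B - (d + 1)) + 60 * queued B ls + unvisited g mate (s.arr 13),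
      .inr ⟨?_, ?_, ?_, ?_, ls, ?_, ?_, ?_⟩, by omega⟩
    all_goals simp only [State.setReg_reg, State.setReg_arr, reduceIte, Nat.reduceEqDiff, hs.reg11,
      ← hB]
    · exact h17
    · exact { ht with dist_le := fun j hj h => (ht.dist_le j hj h).trans (Nat.le_succ _) }
    · exact hmat
    · exact hb
    · exact hq.advance hnil
    · exact le_rfl
  · have h0 : s.arr 10 d ≠ 0 := by simpa using h0
    obtain ⟨l, hl, hcl⟩ := hbd.eq_cons h0
    set e := s.arr 10 d with hee
    obtain ⟨he, hk, -⟩ := hq.mem d hd e (by simp [hl])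
    have hjM := hg.col_lt e he
    have hpop := queued_update (ls := ls) hd l
    rw [hl, List.length_cons] at hpop
    have hbpop : ∀ k < B, Chain (s.arr 11) (Function.update (s.arr 10) d (s.arr 11 e) k)
        (Function.update ls d l k) := by
      intro k hk
      by_cases hkd : k = d
      · subst hkd
        simpa using hcl
      · simpa only [Function.update_of_ne hkd] using hb k hk
    simp only [hs.arr5]
    set j := g.col e with hj
    refine ⟨fun h1 => ?_, fun h1 => ?_⟩
    · have h1 : s.arr 13 j = 0 := by simpa using h1
      have hun := unvisited_update (mate := mate) (c := s.reg 16) hjM h1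
      refine ⟨fun h2 => ?_, fun h2 => ?_⟩
      · have h2 : s.arr 8 j = 0 := by simpa using h2
        rw [h8] at h2
        refine ⟨0, .inl ⟨?_, ?_, ?_⟩, by omega⟩
        all_goals simp only [State.setReg_reg, State.setReg_arr, State.setArr_reg,
          State.setArr_arr, reduceIte, Nat.reduceEqDiff]
        rw [← hdd]
        exact hq.found hg hm ht hmat hd hl rfl h1 h2
      · have h2 : mate j ≠ 0 := by
          rw [← h8]
          simpa using h2
        obtain ⟨-, hcm, hrm, -⟩ := hm.right j hjM h2
        have ht' := ht.visit hg hm he rfl hk h1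
        rw [if_neg h2] at hun
        refine wp_of_frame ((scan_spec (B := B) (ls := Function.update ls d l)
          (a := g.start (g.row (mate j))) (b := g.start (g.row (mate j) + 1))
          (key := fun e' => d + g.cost e' + w (g.col e') - (g.cost (mate j) + w j))
          ?_ ?_ ?_ ?_ ?_ ?_ ?_).mono ?_)
        · intro e'
          simp only [State.setReg_reg, State.setReg_arr, State.setArr_reg,
            State.setArr_arr, reduceIte, Nat.reduceEqDiff, hs.arr6, hs.arr5, h7, h8]
        · simp only [State.setReg_reg, State.setReg_arr, State.setArr_reg,
            State.setArr_arr, reduceIte, Nat.reduceEqDiff, hs.arr3, hs.arr4, h8]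
        · simp only [State.setReg_reg, State.setReg_arr, State.setArr_reg,
            State.setArr_arr, reduceIte, Nat.reduceEqDiff, hs.arr3, hs.arr4, h8]
        · exact hg.start_mono _ (by omega)
        · intro e' h3 h4
          obtain ⟨h5, h6⟩ := hg.mem_row _ (by omega) e' h3 h4
          have h9 := hw.tight j hjM h2 e' h5 h6
          rw [hcm] at h9
          refine ⟨by have := h5.1; omega, ?_⟩
          have h10 := ht'.key_le hg hw (t := s.reg 16 + 1 + 1)
            (k := d + g.cost e' + w (g.col e') - (g.cost (mate j) + w j)) h5 (by
              rw [EdgeList.key_visit_iff hjM h1 ht.stamp_le rfl]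
              exact .inr ⟨h2, h6.symm, by omega⟩)
          simp only [hB]
          omega
        · intro k hk
          simp only [State.setReg_arr, State.setArr_arr, reduceIte, Nat.reduceEqDiff]
          exact hbpop k hk
        · exact fun k hk e' he' => hq.not_mem_row hg hm hr hjM h1 h2 hk
            (EdgeList.mem_of_mem_pop hl he')
        · rintro s' t ⟨ls', hb', hls', hqn, htime⟩ hf
          have r17 := hf.reg 17 (by decide)
          have r14 := hf.reg 14 (by decide)
          have r13 := hf.reg 13 (by decide)
          have r16 := hf.reg 16 (by decide)
          have a12 := hf.arr 12 (by decide)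
          have a13 := hf.arr 13 (by decide)
          have a14 := hf.arr 14 (by decide)
          simp only [State.setReg_reg, State.setReg_arr, State.setArr_reg,
            State.setArr_arr, reduceIte, Nat.reduceEqDiff] at r17 r14 r13 r16 a12 a13 a14
          have hdeg : g.deg (g.row (mate j)) =
            g.start (g.row (mate j) + 1) - g.start (g.row (mate j)) := rfl
          refine ⟨20 * (B - d) + 60 * queued B ls' + unvisited g mate (s'.arr 13),
            .inr ⟨?_, ?_, ?_, ?_, ls', hb', ?_, ?_⟩, ?_⟩
          · rw [r17, h17]
          · rw [r14, r13, h14]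
          · rw [a12, a13, a14, r13, r16]
            exact ht'
          · intro i hi
            rw [a13]
            by_cases hij : i = j
            · rw [hij]
              exact fun _ => h2
            · rw [Function.update_of_ne hij]
              exact hmat i hi
          · rw [a13, a14, r13, r16]
            exact hq.visit hg hm hw hr ht hB hd hl rfl h1 h2 hls'
          · rw [r13]
          · rw [a13]
            omega
    · have h1 : s.arr 13 j ≠ 0 := by simpa using h1
      refine ⟨20 * (B - d) + 60 * queued B (Function.update ls d l) + unvisited g mate (s.arr 13),
        .inr ⟨?_, ?_, ?_, ?_, Function.update ls d l, ?_, ?_, ?_⟩, by omega⟩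
      all_goals try simp only [State.setReg_reg, State.setReg_arr, State.setArr_reg,
          State.setArr_arr, reduceIte, Nat.reduceEqDiff]
      · exact h17
      · exact h14
      · exact ht
      · exact hmat
      · intro k hk
        simp only [State.setReg_arr, State.setArr_arr, reduceIte, Nat.reduceEqDiff]
        exact hbpop k hk
      · exact hq.pop_visited hl h1 (ht.dist_le j hjM h1)
      · exact le_rfl

theorem search_spec {g : EdgeList} {r : ℕ} {w mate rmate : ℕ → ℕ} {s : State}
    (hg : g.WF) (hm : g.IsMatching r mate rmate) (hw : g.Supports w mate) (hr : r < g.M)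
    (hs : Holds g s) (h12 : s.reg 12 = r) (h7 : s.arr 7 = w) (h8 : s.arr 8 = mate)
    (h10 : ∀ k < 4 * (g.n * g.M) + 1, s.arr 10 k = 0)
    (h13 : ∀ j < g.M, s.arr 13 j = 0) :
    wp search s (fun s' t =>
      (s'.reg 17 = 1 ∧ g.Found r w mate (s'.arr 13) (s'.arr 14) (s'.arr 12) (s'.reg 16)
          (s'.reg 13) (s'.reg 5) ∨
        s'.reg 17 = 0 ∧ ∀ f : ℕ → ℕ, Set.InjOn f (Set.Iio g.M) →
          ¬ ∀ i < g.M, ∃ e, g.Valid e ∧ g.row e = i ∧ g.col e = f i) ∧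
      t ≤ 80 * (g.n * g.M) + 200 * g.E + 100 * g.M + 100) := by
  set B := 4 * (g.n * g.M) + 1 with hB
  have hnM : g.n ≤ g.n * g.M := Nat.le_mul_of_pos_right _ (by omega)
  have htree : ∀ dist par : ℕ → ℕ, g.Tree r w mate (s.arr 13) dist par 0 0 := by
    intro dist par
    constructor
    · symm
      rw [Finset.card_eq_zero, Finset.filter_eq_empty_iff]
      intro j hj
      simp [h13 j (Finset.mem_range.1 hj)]
    all_goals intro j hj
    · simp [h13 j hj]
    all_goals intro h; exact absurd (h13 j hj) h
  simp only [search, wp_seq, wp_assign, Expr.eval, Expr.steps]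
  refine wp_of_frame ((scan_spec (B := B) (ls := fun _ => [])
    (a := g.start r) (b := g.start (r + 1))
    (key := fun e' => 0 + g.cost e' + w (g.col e') - 0)
    ?_ ?_ ?_ ?_ ?_ ?_ ?_).mono ?_)
  · intro e'
    simp only [State.setReg_reg, State.setReg_arr, reduceIte, Nat.reduceEqDiff, hs.arr6, hs.arr5,
      h7]
  · simp only [State.setReg_reg, State.setReg_arr, reduceIte, Nat.reduceEqDiff, hs.arr3, h12]
  · simp only [State.setReg_reg, State.setReg_arr, reduceIte, Nat.reduceEqDiff, hs.arr3, h12]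
  · exact hg.start_mono _ hr
  · intro e' h3 h4
    obtain ⟨h5, h6⟩ := hg.mem_row _ hr e' h3 h4
    have h7 := hg.cost_le _ h5
    have h8 := hw.le _ (hg.col_lt _ h5)
    refine ⟨by have := h5.1; omega, by simp only [hB]; omega⟩
  · intro k hk
    simp only [State.setReg_arr]
    exact h10 k hk
  · simp
  · rintro s' t ⟨ls, hb, hls, hqn, htime⟩ hf
    have r17 := hf.reg 17 (by decide)
    have r14 := hf.reg 14 (by decide)
    have r13 := hf.reg 13 (by decide)
    have r16 := hf.reg 16 (by decide)
    have r0 := hf.reg 0 (by decide)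
    have r11 := hf.reg 11 (by decide)
    have a13 := hf.arr 13 (by decide)
    have a3 := hf.arr 3 (by decide)
    have a4 := hf.arr 4 (by decide)
    have a5 := hf.arr 5 (by decide)
    have a6 := hf.arr 6 (by decide)
    have a7 := hf.arr 7 (by decide)
    have a8 := hf.arr 8 (by decide)
    simp only [State.setReg_reg, State.setReg_arr, reduceIte, Nat.reduceEqDiff]
      at r17 r14 r13 r16 r0 r11 a13 a3 a4 a5 a6 a7 a8
    have hrow : g.start (r + 1) ≤ g.start r + g.E := by
      have h1 := Finset.single_le_sum (f := g.deg) (fun i _ => Nat.zero_le _)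
        (Finset.mem_range.2 hr)
      have h2 := hg.sum_deg
      have h3 : g.deg r = g.start (r + 1) - g.start r := rfl
      omega
    have hun := unvisited_le (stamp := s.arr 13) hg hm hr.le
    have hq0 : queued B (fun _ => []) = 0 := by simp [queued]
    rw [hq0] at hqn
    -- No stamp lies strictly between 0 and 1, so at the start only the row `r` supplies keys.
    have hkey : ∀ e k, g.Key r w mate (s.arr 13) (s'.arr 14) (0 + 1) e k →
        g.row e = r ∧ k = g.cost e + w (g.col e) := by
      rintro e k (h | ⟨j, -, h1, h2, -⟩)
      · exact h
      · omega
    refine wp_loop (SearchInv g r w mate)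
      (20 * B + 60 * queued B ls + unvisited g mate (s.arr 13)) ?_ ?_ ?_
    · refine .inr ⟨r17, ?_, ?_, ?_, ls, hb, ?_, ?_⟩
      · rw [r14, r13, if_pos (by omega)]
      · rw [a13, r16, r13]
        exact htree _ _
      · intro j hj h
        rw [a13] at h
        exact absurd (h13 j hj) h
      · rw [a13, r16, r13]
        constructor
        · intro k hk e he
          rcases (hls k hk e).1 he with h | ⟨h1, h2, h3⟩
          · simp at h
          · obtain ⟨h4, h5⟩ := hg.mem_row _ hr e h1 h2
            exact ⟨h4, .inl ⟨h5, by simpa using h3⟩, Nat.zero_le _⟩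
        · intro e k he hk
          have hkB := (htree (s'.arr 14) (s'.arr 12)).key_le hg hw he hk
          obtain ⟨h1, h2⟩ := hkey e k hk
          refine .inl ⟨by omega, (hls k (by omega) e).2 (.inr ?_), Nat.zero_le _⟩
          rw [← h1]
          exact ⟨hg.start_le e he, hg.lt_start e he, by simpa using h2⟩
      · exact le_of_eq (by rw [r13, a13, Nat.sub_zero])
    · intro s'' m hf' hI hrun
      refine (searchBody_spec hg hm hw hr ?_ ?_ ?_ hI hrun).mono fun _ _ h _ => h
      · constructor
        · rw [hf'.reg 0 (by decide), r0, hs.reg0]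
        · rw [hf'.reg 11 (by decide), r11, hs.reg11]
        · rw [hf'.arr 3 (by decide), a3, hs.arr3]
        · rw [hf'.arr 4 (by decide), a4, hs.arr4]
        · rw [hf'.arr 5 (by decide), a5, hs.arr5]
        · rw [hf'.arr 6 (by decide), a6, hs.arr6]
      · rw [hf'.arr 7 (by decide), a7, h7]
      · rw [hf'.arr 8 (by decide), a8, h8]
    · intro s'' m t' hf' hI hrun htime'
      simp only [Expr.steps] at htime'
      simp only [Expr.eval] at hrun
      refine ⟨?_, by omega⟩
      rcases hI with ⟨h1, h2, h3⟩ | ⟨h1, h2, h3, h4, ls', h5, h6, h7⟩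
      · exact .inl ⟨h1, h3⟩
      · refine .inr ⟨h1, h3.not_perfect hg hm hw hr h4 ?_⟩
        intro e k he hk
        -- A stop without success means that the level has passed all buckets. Nothing is queued at
        -- or above it, so every edge leaving the tree ends in a visited column.
        have hd : ¬ s''.reg 13 < B := by
          intro h
          rw [if_pos h, hrun] at h2
          omega
        rcases h6.done e k he hk with ⟨h8, h9, h10⟩ | h8
        · omega
        · exact h8.1

end RAM

/-! ### Augmentation of the matching, and one complete stage -/

namespace EdgeList

variable {g : EdgeList} {r : ℕ} {mate rmate : ℕ → ℕ}

theorem IsMatching.extend (hm : g.IsMatching r mate rmate) {e : ℕ} (he : g.Valid e)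
    (hr : g.row e = r) (hfree : mate (g.col e) = 0) :
    g.IsMatching (r + 1) (Function.update mate (g.col e) e) (Function.update rmate r e) := by
  constructor
  · intro i hi
    by_cases hir : i = r
    · subst hir
      simp [he, hr]
    · obtain ⟨h1, h2, h3⟩ := hm.left i (by omega)
      rw [Function.update_of_ne hir]
      refine ⟨h1, h2, ?_⟩
      rw [Function.update_of_ne, h3]
      intro h
      rw [h, hfree] at h3
      have := h1.1
      omega
  · intro j hj hmj
    by_cases hjc : j = g.col e
    · subst hjc
      simp [he, hr]
    · rw [Function.update_of_ne hjc] at hmj ⊢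
      obtain ⟨h1, h2, h3, h4⟩ := hm.right j hj hmj
      refine ⟨h1, h2, by omega, ?_⟩
      rw [Function.update_of_ne (by omega), h4]

/-- One step back along the augmenting path: a row trades its column `j` for the column of `e`, and
the hole in the matching moves to `j`. -/
theorem IsMatching.exchange (hm : g.IsMatching r mate rmate) {e j : ℕ}
    (he : g.Valid e) (hfree : mate (g.col e) = 0) (hj : j < g.M) (hmj : mate j ≠ 0)
    (hr : g.row (mate j) = g.row e) :
    g.IsMatching r (Function.update (Function.update mate (g.col e) e) j 0)
      (Function.update rmate (g.row e) e) := by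
  have hjc : g.col e ≠ j := by
    rintro rfl
    exact hmj hfree
  obtain ⟨k1, k2, k3, k4⟩ := hm.right j hj hmj
  have he0 := he.1
  constructor
  · intro i hi
    by_cases hir : i = g.row e
    · subst hir
      simp [he, hjc]
    · obtain ⟨h1, h2, h3⟩ := hm.left i hi
      rw [Function.update_of_ne hir]
      refine ⟨h1, h2, ?_⟩
      rw [Function.update_of_ne, Function.update_of_ne, h3]
      · intro h
        rw [h, hfree] at h3
        have := h1.1
        omega
      · intro h
        rw [h] at h3
        rw [h3, h2] at hr
        exact hir hr
  · intro j' hj' hmj'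
    by_cases hjj : j' = j
    · subst hjj
      simp at hmj'
    · rw [Function.update_of_ne hjj] at hmj' ⊢
      by_cases hjc' : j' = g.col e
      · subst hjc'
        simp [he]
        omega
      · rw [Function.update_of_ne hjc'] at hmj' ⊢
        obtain ⟨h1, h2, h3, h4⟩ := hm.right j' hj' hmj'
        refine ⟨h1, h2, h3, ?_⟩
        rw [Function.update_of_ne, h4]
        intro h
        exact hjj (hm.row_inj hj' hj hmj' hmj (h.trans hr.symm))

end EdgeList

namespace RAM

/-- The state of the augmentation, with the time `m` still to be spent. -/
def AugmentInv (g : EdgeList) (r : ℕ) (w mate stamp : ℕ → ℕ) (s : State) (m : ℕ) : Prop :=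
  (∀ i < g.M, s.arr 8 i ≠ 0 → g.Tight w (s.arr 8 i)) ∧
  ((s.reg 14 = 0 ∧ g.IsMatching (r + 1) (s.arr 8) (s.arr 9) ∧
      ∀ i < g.M, s.arr 8 i = 0 → mate i = 0) ∨
    (s.reg 14 = 1 ∧ g.IsMatching r (s.arr 8) (s.arr 9) ∧ s.reg 5 < g.M ∧ stamp (s.reg 5) ≠ 0 ∧
      s.arr 8 (s.reg 5) = 0 ∧
      (∀ i < g.M, i ≠ s.reg 5 → s.arr 8 i = 0 → mate i = 0) ∧
      (∀ i < g.M, stamp i ≠ 0 → stamp i < stamp (s.reg 5) → s.arr 8 i = mate i) ∧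
      40 * stamp (s.reg 5) ≤ m))

/-- The path is followed from its free end, with register `5` holding the current hole. Stamps
decrease along parents, which bounds the number of passes and ensures that columns still to be met
carry their original mates. -/
theorem augment_spec {g : EdgeList} {r cnt d j : ℕ}
    {w w' mate rmate stamp dist par : ℕ → ℕ} {s : State}
    (hm : g.IsMatching r mate rmate)
    (hf : g.Found r w mate stamp dist par cnt d j)
    (htm : ∀ i < g.M, mate i ≠ 0 → g.Tight w' (mate i))
    (htp : ∀ i < g.M, stamp i ≠ 0 → g.Tight w' (par i))
    (hs : Holds g s) (h12 : s.reg 12 = r) (h5 : s.reg 5 = j) (h8 : s.arr 8 = mate)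
    (h9 : s.arr 9 = rmate) (ha12 : s.arr 12 = par) :
    wp augment s (fun s' t => g.IsMatching (r + 1) (s'.arr 8) (s'.arr 9) ∧
      (∀ i < g.M, s'.arr 8 i ≠ 0 → g.Tight w' (s'.arr 8 i)) ∧
      (∀ i < g.M, s'.arr 8 i = 0 → mate i = 0) ∧ t ≤ 40 * g.M + 20) := by
  simp only [augment, wp_seq, wp_assign, Expr.eval, Expr.steps]
  refine wp_loop (AugmentInv g r w' mate stamp) (40 * g.M) ?_ ?_ ?_
  · simp only [AugmentInv, State.setReg_reg, State.setReg_arr, reduceIte, Nat.reduceEqDiff, h8, h9,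
      h5]
    refine ⟨htm, .inr ⟨trivial, hm, hf.lt, hf.stamp_ne, hf.free, fun _ _ _ h => h,
      fun _ _ _ _ => trivial, ?_⟩⟩
    have h1 := hf.tree.stamp_le j hf.lt
    have h2 := hf.tree.cnt_le
    omega
  · rintro s' m hfr ⟨ht, ⟨h, -⟩ | ⟨h14, hm', hjM, hst, hfree, hz, hun, hpot⟩⟩ hrun
    · exact absurd h hrun
    have r12 := hfr.reg 12 (by decide)
    have a12 := hfr.arr 12 (by decide)
    have a4 := hfr.arr 4 (by decide)
    have a5 := hfr.arr 5 (by decide)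
    simp only [State.setReg_reg, State.setReg_arr, reduceIte, Nat.reduceEqDiff, h12, ha12,
      hs.arr4, hs.arr5] at r12 a12 a4 a5
    obtain ⟨he, hce, hk⟩ := hf.tree.par _ hjM hst
    have htp' := htp _ hjM hst
    simp only [augmentBody, wp_seq, wp_assign, wp_store, wp_cond, Expr.eval, Expr.steps,
      State.setReg_reg, State.setReg_arr, State.setArr_reg, State.setArr_arr, reduceIte,
      Nat.reduceEqDiff, r12, a12, a4, a5]
    set k := s'.reg 5 with hk5
    set e := par k with hek
    have he0 := he.1
    refine ⟨fun h0 _ => ?_, fun h0 _ => ?_⟩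
    · have h0 : g.row e = r := by
        by_contra h
        simp [h] at h0
      refine ⟨0, ?_, by omega⟩
      simp only [AugmentInv, State.setReg_reg, State.setReg_arr, State.setArr_reg,
        State.setArr_arr, reduceIte, Nat.reduceEqDiff]
      refine ⟨?_, .inl ⟨trivial, ?_, ?_⟩⟩
      · intro i hi
        by_cases hik : i = k
        · rw [hik, Function.update_self]
          exact fun _ => htp'
        · rw [Function.update_of_ne hik]
          exact ht i hi
      · have := hm'.extend he h0 (by rw [hce]; exact hfree)
        rw [hce] at this
        rw [h0]
        exact this
      · intro i hi
        by_cases hik : i = k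
        · rw [hik, Function.update_self]
          intro h
          omega
        · rw [Function.update_of_ne hik]
          exact hz i hi hik
    · have h0 : g.row e ≠ r := by
        intro h
        simp [h] at h0
      rcases hk with ⟨h, -⟩ | ⟨j₀, h1, h2, h3, h4, h6, -⟩
      · exact absurd h h0
      have h7 := hun j₀ h1 (by omega) h3
      have h10 := hm'.right j₀ h1 (by rw [h7]; exact h4)
      rw [h7] at h10
      obtain ⟨-, h11, -, h13⟩ := h10
      rw [h6] at h13
      have hjk : k ≠ j₀ := by
        rintro h
        rw [h] at h3
        omega
      refine ⟨40 * stamp j₀, ?_, by omega⟩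
      simp only [AugmentInv, State.setReg_reg, State.setReg_arr, State.setArr_reg,
        State.setArr_arr, reduceIte, Nat.reduceEqDiff, h13, h11]
      refine ⟨?_, .inr ⟨?_, ?_, h1, by omega, ?_, ?_, ?_, le_rfl⟩⟩
      · intro i hi
        by_cases hij : i = j₀
        · rw [hij, Function.update_self]
          exact fun h => absurd rfl h
        · rw [Function.update_of_ne hij]
          by_cases hik : i = k
          · rw [hik, Function.update_self]
            exact fun _ => htp'
          · rw [Function.update_of_ne hik]
            exact ht i hi
      · exact h14
      · have := hm'.exchange he (by rw [hce]; exact hfree) h1 (by rw [h7]; exact h4)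
          (by rw [h7]; exact h6)
        rw [hce] at this
        exact this
      · rw [Function.update_self]
      · intro i hi hij
        rw [Function.update_of_ne hij]
        by_cases hik : i = k
        · rw [hik, Function.update_self]
          intro h
          omega
        · rw [Function.update_of_ne hik]
          exact hz i hi hik
      · intro i hi hsi hlt
        rw [Function.update_of_ne (by rintro rfl; omega),
          Function.update_of_ne (by rintro rfl; omega)]
        exact hun i hi hsi (by omega)
  · rintro s' m t hfr ⟨ht, ⟨-, hm', hz⟩ | ⟨h, -⟩⟩ hrun htime
    · simp only [Expr.steps] at htime
      exact ⟨hm', ht, hz, by omega⟩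
    · simp only [Expr.eval] at hrun
      omega

theorem stage_spec {g : EdgeList} {r : ℕ} {s : State} (hg : g.WF)
    (hm : g.IsMatching r (s.arr 8) (s.arr 9)) (hw : g.Supports (s.arr 7) (s.arr 8))
    (hn : 0 < g.n) (hr : r < g.M) (hs : Holds g s) (h12 : s.reg 12 = r) :
    wp stage s (fun s' t =>
      (s'.reg 12 = r + 1 ∧ s'.reg 23 = (if r + 1 < g.M then 1 else 0) ∧
          g.IsMatching (r + 1) (s'.arr 8) (s'.arr 9) ∧ g.Supports (s'.arr 7) (s'.arr 8) ∨
        s'.reg 12 = r ∧ s'.reg 23 = 0 ∧ ∀ f : ℕ → ℕ, Set.InjOn f (Set.Iio g.M) →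
          ¬ ∀ i < g.M, ∃ e, g.Valid e ∧ g.row e = i ∧ g.col e = f i) ∧
      t ≤ 200 * (g.n * g.M + g.E + g.M + 1)) := by
  -- Because `n` is positive, the cells erased by `clear`, one per bucket, include the stamps of all
  -- columns.
  have hMn : g.M ≤ g.n * g.M := Nat.le_mul_of_pos_left _ hn
  simp only [stage, wp_seq]
  refine wp_of_frame (clear_spec.mono ?_)
  rintro s₁ t₁ ⟨hc, ht₁⟩ hf₁
  rw [hs.reg11] at hc ht₁
  have hs₁ : Holds g s₁ := by
    constructor
    · rw [hf₁.reg 0 (by decide), hs.reg0]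
    · rw [hf₁.reg 11 (by decide), hs.reg11]
    · rw [hf₁.arr 3 (by decide), hs.arr3]
    · rw [hf₁.arr 4 (by decide), hs.arr4]
    · rw [hf₁.arr 5 (by decide), hs.arr5]
    · rw [hf₁.arr 6 (by decide), hs.arr6]
  refine wp_of_frame ((search_spec hg hm hw hr hs₁ ((hf₁.reg 12 (by decide)).trans h12)
    (hf₁.arr 7 (by decide)) (hf₁.arr 8 (by decide)) (fun k hk => (hc k hk).1)
    (fun j hj => (hc j (by omega)).2)).mono ?_)
  rintro s₂ t₂ ⟨hres, ht₂⟩ hf₂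
  have hs₂ : Holds g s₂ := by
    constructor
    · rw [hf₂.reg 0 (by decide), hs₁.reg0]
    · rw [hf₂.reg 11 (by decide), hs₁.reg11]
    · rw [hf₂.arr 3 (by decide), hs₁.arr3]
    · rw [hf₂.arr 4 (by decide), hs₁.arr4]
    · rw [hf₂.arr 5 (by decide), hs₁.arr5]
    · rw [hf₂.arr 6 (by decide), hs₁.arr6]
  have r12 : s₂.reg 12 = r := by rw [hf₂.reg 12 (by decide), hf₁.reg 12 (by decide), h12]
  have a7 : s₂.arr 7 = s.arr 7 := by rw [hf₂.arr 7 (by decide), hf₁.arr 7 (by decide)]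
  have a8 : s₂.arr 8 = s.arr 8 := by rw [hf₂.arr 8 (by decide), hf₁.arr 8 (by decide)]
  have a9 : s₂.arr 9 = s.arr 9 := by rw [hf₂.arr 9 (by decide), hf₁.arr 9 (by decide)]
  simp only [wp_cond, wp_assign, wp_seq, Expr.eval, Expr.steps]
  rcases hres with ⟨h17, hF⟩ | ⟨h17, hno⟩
  · refine ⟨fun _ => ?_, fun h => by omega⟩
    refine wp_of_frame (reprice_spec.mono ?_)
    rintro s₃ t₃ ⟨hp, ht₃⟩ hf₃
    rw [hs₂.reg0] at hp ht₃
    rw [a7] at hp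
    have hs₃ : Holds g s₃ := by
      constructor
      · rw [hf₃.reg 0 (by decide), hs₂.reg0]
      · rw [hf₃.reg 11 (by decide), hs₂.reg11]
      · rw [hf₃.arr 3 (by decide), hs₂.arr3]
      · rw [hf₃.arr 4 (by decide), hs₂.arr4]
      · rw [hf₃.arr 5 (by decide), hs₂.arr5]
      · rw [hf₃.arr 6 (by decide), hs₂.arr6]
    refine wp_of_frame ((augment_spec hm hF
      (w' := EdgeList.newPrice (s.arr 7) (s₂.arr 13) (s₂.arr 14) (s₂.reg 13))
      (fun i hi hmi => hF.tight_mate hm hw hi hmi)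
      (fun i hi hsi => hF.tight_par hm hw hi hsi) hs₃
      (by rw [hf₃.reg 12 (by decide), r12]) (hf₃.reg 5 (by decide))
      (by rw [hf₃.arr 8 (by decide), a8]) (by rw [hf₃.arr 9 (by decide), a9])
      (hf₃.arr 12 (by decide))).mono ?_)
    rintro s₄ t₄ ⟨hm₄, htight, hfree, ht₄⟩ hf₄
    have r12' : s₄.reg 12 = r := by
      rw [hf₄.reg 12 (by decide), hf₃.reg 12 (by decide), r12]
    have r0' : s₄.reg 0 = g.M := by rw [hf₄.reg 0 (by decide), hs₃.reg0]
    have a7' : ∀ i < g.M, s₄.arr 7 i =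
        EdgeList.newPrice (s.arr 7) (s₂.arr 13) (s₂.arr 14) (s₂.reg 13) i := by
      intro i hi
      rw [hf₄.arr 7 (by decide), hp i hi]
      rfl
    simp only [State.setReg_reg, State.setReg_arr, reduceIte, Nat.reduceEqDiff, r12', r0']
    refine ⟨.inl ⟨trivial, trivial, hm₄, ?_, ?_, ?_⟩, by omega⟩
    · intro i hi hmi e' he' hre
      have := htight i hi hmi e' he' hre
      rwa [a7' _ (hg.col_lt _ he'), a7' _ (hg.col_lt _ (hm₄.right i hi hmi).1)]
    · intro i hi hmi
      rw [a7' i hi]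
      exact hF.newPrice_free hw hi (hfree i hi hmi)
    · intro i hi
      rw [a7' i hi]
      exact hF.newPrice_le hw hi
  · refine ⟨fun h => absurd h17 h, fun _ => ?_⟩
    simp only [State.setReg_reg, reduceIte, Nat.reduceEqDiff, r12]
    exact ⟨.inr ⟨trivial, trivial, hno⟩, by omega⟩

end RAM

/-! ### Listing the edges -/

/-- The edges of cost at most `ρ` in the rows before `i`, and in the row `i` before the column `j`,
have been listed. -/
structure Listed (M ρ : ℕ) (D : ℕ → ℕ → ℕ) (start row col cost : ℕ → ℕ) (E i j : ℕ) : Prop where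
  start_zero : start 0 = 1
  start_mono : ∀ a < i, start a ≤ start (a + 1)
  start_last : start i ≤ E
  edge : ∀ e, 1 ≤ e → e < E → (row e < i ∨ row e = i ∧ col e < j) ∧ col e < M ∧
    cost e = D (row e) (col e) ∧ cost e ≤ ρ ∧ start (row e) ≤ e ∧
    (row e < i → e < start (row e + 1))
  all : ∀ a b, (a < i ∧ b < M ∨ a = i ∧ b < j) → D a b ≤ ρ →
    ∃ e, 1 ≤ e ∧ e < E ∧ row e = a ∧ col e = b
  mem_row : ∀ a < i, ∀ e, start a ≤ e → e < start (a + 1) → 1 ≤ e ∧ e < E ∧ row e = a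
  last_row : ∀ e, start i ≤ e → e < E → 1 ≤ e ∧ row e = i
  count : E = ∑ a ∈ Finset.range i, ∑ b ∈ Finset.range M, (if D a b ≤ ρ then 1 else 0) +
    ∑ b ∈ Finset.range j, (if D i b ≤ ρ then 1 else 0) + 1

namespace Listed

variable {M ρ : ℕ} {D : ℕ → ℕ → ℕ} {start row col cost : ℕ → ℕ} {E i j : ℕ}

/-- Numbering starts at 1 since `0` is the null edge, marking empty buckets and unmatched columns.
-/
theorem empty : Listed M ρ D (Function.update start 0 1) row col cost 1 0 0 := by
  constructor <;> simp
  · intro e h1 h2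
    omega
  · intro e h1 h2
    omega

theorem skip (h : Listed M ρ D start row col cost E i j) (hD : ¬ D i j ≤ ρ) :
    Listed M ρ D start row col cost E i (j + 1) := by
  refine ⟨h.start_zero, h.start_mono, h.start_last, ?_, ?_, h.mem_row, h.last_row, ?_⟩
  · intro e h1 h2
    obtain ⟨h3, h4⟩ := h.edge e h1 h2
    exact ⟨by omega, h4⟩
  · intro a b hab hle
    refine h.all a b ?_ hle
    rcases hab with hab | ⟨rfl, hb⟩
    · exact .inl hab
    · refine .inr ⟨rfl, ?_⟩
      have : b ≠ j := by
        rintro rfl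
        exact hD hle
      omega
  · rw [Finset.sum_range_succ, if_neg hD]
    have := h.count
    omega

theorem add (h : Listed M ρ D start row col cost E i j) (hD : D i j ≤ ρ) (hj : j < M) :
    Listed M ρ D start (Function.update row E i) (Function.update col E j)
      (Function.update cost E (D i j)) (E + 1) i (j + 1) := by
  have hE : 1 ≤ E := by
    have := h.count
    omega
  refine ⟨h.start_zero, h.start_mono, h.start_last.trans (Nat.le_succ _), ?_, ?_, ?_, ?_, ?_⟩
  · intro e h1 h2
    by_cases he : e = E
    · subst he
      simp only [Function.update_self]
      exact ⟨.inr ⟨trivial, by omega⟩, hj, trivial, hD, h.start_last, fun h => absurd h (lt_irrefl _)⟩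
    · simp only [Function.update_of_ne he]
      obtain ⟨h3, h4⟩ := h.edge e h1 (by omega)
      exact ⟨by omega, h4⟩
  · intro a b hab hle
    have old : (∃ e, 1 ≤ e ∧ e < E ∧ row e = a ∧ col e = b) →
        ∃ e, 1 ≤ e ∧ e < E + 1 ∧ Function.update row E i e = a ∧
          Function.update col E j e = b := by
      rintro ⟨e, h1, h2, h3, h4⟩
      refine ⟨e, h1, by omega, ?_, ?_⟩
      · rw [Function.update_of_ne (by omega), h3]
      · rw [Function.update_of_ne (by omega), h4]
    rcases hab with hab | ⟨rfl, hb⟩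
    · exact old (h.all a b (.inl hab) hle)
    · by_cases hbj : b = j
      · exact ⟨E, hE, by omega, by simp, by simp [hbj]⟩
      · exact old (h.all a b (.inr ⟨rfl, by omega⟩) hle)
  · intro a ha e h1 h2
    obtain ⟨h3, h4, h5⟩ := h.mem_row a ha e h1 h2
    exact ⟨h3, by omega, by rw [Function.update_of_ne (by omega), h5]⟩
  · intro e h1 h2
    by_cases he : e = E
    · subst he
      simp [hE]
    · rw [Function.update_of_ne he]
      exact h.last_row e h1 (by omega)
  · rw [Finset.sum_range_succ, if_pos hD]
    have := h.count
    omega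

theorem next_row (h : Listed M ρ D start row col cost E i M) :
    Listed M ρ D (Function.update start (i + 1) E) row col cost E (i + 1) 0 := by
  have old : ∀ a ≤ i, Function.update start (i + 1) E a = start a := by
    intro a ha
    rw [Function.update_of_ne (by omega)]
  refine ⟨?_, ?_, ?_, ?_, ?_, ?_, ?_, ?_⟩
  · rw [old 0 (by omega), h.start_zero]
  · intro a ha
    by_cases hai : a = i
    · subst hai
      rw [old a le_rfl, Function.update_self]
      exact h.start_last
    · rw [old a (by omega), old (a + 1) (by omega)]
      exact h.start_mono a (by omega)
  · simp
  · intro e h1 h2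
    obtain ⟨h3, h4, h5, h6, h7, h8⟩ := h.edge e h1 h2
    refine ⟨.inl (by omega), h4, h5, h6, ?_, fun _ => ?_⟩
    · rw [old _ (by omega)]
      exact h7
    · by_cases hai : row e = i
      · rw [hai, Function.update_self]
        exact h2
      · rw [old _ (by omega)]
        exact h8 (by omega)
  · intro a b hab hle
    refine h.all a b ?_ hle
    omega
  · intro a ha e h1 h2
    rw [old a (by omega)] at h1
    by_cases hai : a = i
    · subst hai
      rw [Function.update_self] at h2
      obtain ⟨h3, h4⟩ := h.last_row e h1 h2
      exact ⟨h3, h2, h4⟩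
    · rw [old (a + 1) (by omega)] at h2
      exact h.mem_row a (by omega) e h1 h2
  · intro e h1 h2
    rw [Function.update_self] at h1
    omega
  · rw [Finset.sum_range_succ, Finset.sum_range_zero, add_zero]
    exact h.count

/-- The list of edges, once complete. -/
theorem wf {n : ℕ} (h : Listed M ρ D start row col cost E M 0)
    (hD : ∀ a b, D a b ≤ n) (hE : start M = E) :
    EdgeList.WF ⟨M, n, E, start, row, col, cost⟩ := by
  refine ⟨h.start_zero, hE, h.start_mono, ?_, ?_, ?_, ?_, ?_, ?_⟩
  · intro a ha e h1 h2
    obtain ⟨h3, h4, h5⟩ := h.mem_row a ha e h1 h2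
    exact ⟨⟨h3, h4⟩, h5⟩
  all_goals
    rintro e ⟨h1, h2⟩
    obtain ⟨h3, h4, h5, h6, h7, h8⟩ := h.edge e h1 h2
    simp only at h1 h2 ⊢
  · omega
  · exact h7
  · exact h8 (by omega)
  · exact h4
  · rw [h5]
    exact hD _ _

end Listed

namespace RAM

/-- The number of places where the segments of length `n` of `A` from `p` and `A'` from `q`
differ. -/
def segmentDist (A A' : ℕ → ℕ) (n p q : ℕ) : ℕ :=
  ∑ k ∈ Finset.range n, (1 - if A (p + k) = A' (q + k) then 1 else 0)

theorem distance_spec {s : State} :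
    wp distance s (fun s' t =>
      s'.reg 9 = segmentDist (s.arr 0) (s.arr 1) (s.reg 1) (s.reg 6) (s.reg 7) ∧
      t ≤ 30 * s.reg 1 + 20) := by
  simp only [distance, wp_seq, wp_assign, Expr.eval, Expr.steps]
  refine wp_loop (fun s' m => s'.reg 8 ≤ s.reg 1 ∧
      s'.reg 9 = segmentDist (s.arr 0) (s.arr 1) (s'.reg 8) (s.reg 6) (s.reg 7) ∧
      m = 30 * (s.reg 1 - s'.reg 8)) (30 * s.reg 1) ?_ ?_ ?_
  · simp [State.setReg_reg, segmentDist]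
  · rintro s' m hf ⟨h1, h2, h3⟩ hlt'
    have r1 := hf.reg 1 (by decide)
    have r6 := hf.reg 6 (by decide)
    have r7 := hf.reg 7 (by decide)
    have a0 := hf.arr 0 (by decide)
    have a1 := hf.arr 1 (by decide)
    simp [State.setReg_reg, State.setReg_arr] at r1 r6 r7 a0 a1
    simp [Expr.eval, r1] at hlt'
    simp only [wp_seq, wp_assign, Expr.eval, Expr.steps, State.setReg_reg,
      a0, a1, r6, r7, reduceIte, Nat.reduceEqDiff]
    intro _
    refine ⟨_, ⟨by omega, ?_, rfl⟩, by omega⟩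
    rw [h2, segmentDist, segmentDist, Finset.sum_range_succ]
  · rintro s' m t hf ⟨h1, h2, h3⟩ hlt' ht
    have r1 := hf.reg 1 (by decide)
    simp [State.setReg_reg] at r1
    simp [Expr.eval, r1, Expr.steps] at hlt' ht
    have : s'.reg 8 = s.reg 1 := by omega
    rw [this] at h2
    exact ⟨h2, by omega⟩

theorem columnBody_spec {s : State} {M ρ n i j : ℕ} {D : ℕ → ℕ → ℕ}
    (h1 : s.reg 1 = n) (h2 : s.reg 2 = ρ) (h4 : s.reg 4 = i) (h5 : s.reg 5 = j)
    (hj : j < M)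
    (hD : segmentDist (s.arr 0) (s.arr 1) n (s.reg 6) (s.reg 7) = D i j)
    (hL : Listed M ρ D (s.arr 3) (s.arr 4) (s.arr 5) (s.arr 6) (s.reg 10) i j) :
    wp columnBody s (fun s' t =>
      Listed M ρ D (s'.arr 3) (s'.arr 4) (s'.arr 5) (s'.arr 6) (s'.reg 10) i (j + 1) ∧
      s'.reg 5 = j + 1 ∧ s'.reg 7 = s.reg 7 + n ∧ t ≤ 30 * n + 50) := by
  simp only [columnBody, wp_seq]
  refine wp_of_frame (distance_spec.mono ?_)
  rintro s₁ t₁ ⟨hd, ht₁⟩ hf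
  have r1 := hf.reg 1 (by decide)
  have r2 := hf.reg 2 (by decide)
  have r4 := hf.reg 4 (by decide)
  have r5 := hf.reg 5 (by decide)
  have r7 := hf.reg 7 (by decide)
  have r10 := hf.reg 10 (by decide)
  have a3 := hf.arr 3 (by decide)
  have a4 := hf.arr 4 (by decide)
  have a5 := hf.arr 5 (by decide)
  have a6 := hf.arr 6 (by decide)
  rw [h1] at r1 hd ht₁
  rw [hD] at hd
  rw [h2] at r2
  rw [h4] at r4
  rw [h5] at r5
  simp only [wp_seq, wp_assign, wp_store, wp_cond, wp_skip, Expr.eval, Expr.steps,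
    State.setReg_reg, State.setReg_arr, State.setArr_reg, State.setArr_arr, reduceIte,
    Nat.reduceEqDiff, r1, r2, r4, r5, r7, r10, a3, a4, a5, a6, hd]
  refine ⟨fun h => ?_, fun h => ?_⟩
  · have h : D i j ≤ ρ := by
      by_contra h'
      simp [show ¬ D i j < ρ + 1 by omega] at h
    exact ⟨hL.add h hj, trivial, trivial, by omega⟩
  · have h : ¬ D i j ≤ ρ := by
      intro h'
      simp [show D i j < ρ + 1 by omega] at h
    exact ⟨hL.skip h, trivial, trivial, by omega⟩

/-- Between two rows the start of the next row is not yet stored. The updates of array `3` in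
hypothesis and conclusion anticipate this pending write; for the last row, `listEdges` performs it
after its loop. -/
theorem rowBody_spec {s : State} {M ρ n i : ℕ} {D : ℕ → ℕ → ℕ}
    (h0 : s.reg 0 = M) (h1 : s.reg 1 = n) (h2 : s.reg 2 = ρ) (h4 : s.reg 4 = i)
    (hD : ∀ j < M, segmentDist (s.arr 0) (s.arr 1) n (s.reg 6) (j * n) = D i j)
    (hL : Listed M ρ D (Function.update (s.arr 3) i (s.reg 10)) (s.arr 4) (s.arr 5) (s.arr 6)
      (s.reg 10) i 0) :
    wp rowBody s (fun s' t =>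
      Listed M ρ D (Function.update (s'.arr 3) (i + 1) (s'.reg 10)) (s'.arr 4) (s'.arr 5)
        (s'.arr 6) (s'.reg 10) (i + 1) 0 ∧
      s'.reg 4 = i + 1 ∧ s'.reg 6 = s.reg 6 + n ∧ t ≤ M * (30 * n + 60) + 50) := by
  simp only [rowBody, wp_seq, wp_assign, wp_store, Expr.eval, Expr.steps]
  refine wp_loop (fun s' m => s'.reg 5 ≤ M ∧ s'.reg 7 = s'.reg 5 * n ∧
      Listed M ρ D (s'.arr 3) (s'.arr 4) (s'.arr 5) (s'.arr 6) (s'.reg 10) i (s'.reg 5) ∧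
      m = (M - s'.reg 5) * (30 * n + 60)) (M * (30 * n + 60)) ?_ ?_ ?_
  · simp only [State.setReg_reg, State.setReg_arr, State.setArr_reg, State.setArr_arr, reduceIte,
      Nat.reduceEqDiff, h4]
    exact ⟨Nat.zero_le _, by simp, hL, by simp⟩
  · rintro s' m hf ⟨k1, k2, k3, k4⟩ hlt
    have r0 := hf.reg 0 (by decide)
    have r1 := hf.reg 1 (by decide)
    have r2 := hf.reg 2 (by decide)
    have r4 := hf.reg 4 (by decide)
    have r6 := hf.reg 6 (by decide)
    have a0 := hf.arr 0 (by decide)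
    have a1 := hf.arr 1 (by decide)
    simp only [State.setReg_reg, State.setReg_arr, State.setArr_reg, State.setArr_arr, reduceIte,
      Nat.reduceEqDiff, h0, h1, h2, h4] at r0 r1 r2 r4 r6 a0 a1
    have hlt : s'.reg 5 < M := by
      by_contra h
      simp [Expr.eval, r0, h] at hlt
    refine (columnBody_spec r1 r2 r4 rfl hlt ?_ k3).mono ?_
    · rw [a0, a1, r6, k2]
      exact hD _ hlt
    · rintro s'' t ⟨l1, l2, l3, l4⟩ -
      refine ⟨_, ⟨?_, ?_, ?_, rfl⟩, ?_⟩
      · omega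
      · rw [l3, l2, k2]
        ring
      · rw [l2]
        exact l1
      · rw [l2, k4]
        have : M - s'.reg 5 = M - (s'.reg 5 + 1) + 1 := by omega
        rw [this, Nat.add_mul]
        simp only [Expr.steps]
        omega
  · rintro s' m t hf ⟨k1, k2, k3, k4⟩ hlt ht
    have r0 := hf.reg 0 (by decide)
    have r1 := hf.reg 1 (by decide)
    have r4 := hf.reg 4 (by decide)
    have r6 := hf.reg 6 (by decide)
    simp only [State.setReg_reg, State.setArr_reg, reduceIte,
      Nat.reduceEqDiff, h0, h1, h4] at r0 r1 r4 r6
    have hlt : s'.reg 5 = M := by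
      by_contra h
      simp [Expr.eval, r0, show s'.reg 5 < M by omega] at hlt
    rw [hlt] at k3
    simp only [Expr.steps] at ht
    simp only [State.setReg_reg, State.setReg_arr, reduceIte, Nat.reduceEqDiff, r1, r4, r6]
    exact ⟨k3.next_row, trivial, trivial, by omega⟩

theorem listEdges_spec {s : State} {M ρ n : ℕ} {D : ℕ → ℕ → ℕ}
    (h0 : s.reg 0 = M) (h1 : s.reg 1 = n) (h2 : s.reg 2 = ρ)
    (hD : ∀ i < M, ∀ j < M, segmentDist (s.arr 0) (s.arr 1) n (i * n) (j * n) = D i j) :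
    wp listEdges s (fun s' t =>
      Listed M ρ D (s'.arr 3) (s'.arr 4) (s'.arr 5) (s'.arr 6) (s'.reg 10) M 0 ∧
      s'.arr 3 M = s'.reg 10 ∧ s'.reg 6 = M * n ∧ t ≤ M * (M * (30 * n + 60) + 60) + 20) := by
  simp only [listEdges, wp_seq, wp_assign, wp_store, Expr.eval, Expr.steps]
  refine wp_loop (fun s' m => s'.reg 4 ≤ M ∧ s'.reg 6 = s'.reg 4 * n ∧
      Listed M ρ D (Function.update (s'.arr 3) (s'.reg 4) (s'.reg 10)) (s'.arr 4) (s'.arr 5)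
        (s'.arr 6) (s'.reg 10) (s'.reg 4) 0 ∧
      m = (M - s'.reg 4) * (M * (30 * n + 60) + 60)) (M * (M * (30 * n + 60) + 60)) ?_ ?_ ?_
  · simp only [State.setReg_reg, State.setReg_arr, reduceIte, Nat.reduceEqDiff]
    exact ⟨Nat.zero_le _, by simp, Listed.empty, by simp⟩
  · rintro s' m hf ⟨k1, k2, k3, k4⟩ hlt
    have r0 := hf.reg 0 (by decide)
    have r1 := hf.reg 1 (by decide)
    have r2 := hf.reg 2 (by decide)
    have a0 := hf.arr 0 (by decide)
    have a1 := hf.arr 1 (by decide)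
    simp only [State.setReg_reg, State.setReg_arr, reduceIte, Nat.reduceEqDiff, h0, h1, h2]
      at r0 r1 r2 a0 a1
    have hlt : s'.reg 4 < M := by
      by_contra h
      simp [Expr.eval, r0, h] at hlt
    refine (rowBody_spec r0 r1 r2 rfl ?_ k3).mono ?_
    · rw [a0, a1, k2]
      exact hD _ hlt
    · rintro s'' t ⟨l1, l2, l3, l4⟩ -
      refine ⟨_, ⟨?_, ?_, ?_, rfl⟩, ?_⟩
      · omega
      · rw [l3, l2, k2]
        ring
      · rw [l2]
        exact l1
      · rw [l2, k4]
        have : M - s'.reg 4 = M - (s'.reg 4 + 1) + 1 := by omega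
        rw [this, Nat.add_mul (M - (s'.reg 4 + 1))]
        simp only [Expr.steps]
        omega
  · rintro s' m t hf ⟨k1, k2, k3, k4⟩ hlt ht
    have r0 := hf.reg 0 (by decide)
    simp only [State.setReg_reg, reduceIte, Nat.reduceEqDiff, h0] at r0
    have hlt : s'.reg 4 = M := by
      by_contra h
      simp [Expr.eval, r0, show s'.reg 4 < M by omega] at hlt
    rw [hlt] at k3 k2
    simp only [Expr.steps] at ht
    simp only [State.setArr_reg, State.setArr_arr, reduceIte, Nat.reduceEqDiff, hlt]
    exact ⟨k3, by simp, k2, by omega⟩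

end RAM

/-! ### Optimality by linear programming duality -/

theorem sum_comp_eq_sum_range {M : ℕ} {f : ℕ → ℕ} (w : ℕ → ℕ) (hf : Set.InjOn f (Set.Iio M))
    (hM : ∀ i < M, f i < M) :
    ∑ i ∈ Finset.range M, w (f i) = ∑ j ∈ Finset.range M, w j := by
  have hinj : Set.InjOn f (Finset.range M : Set ℕ) := by
    intro i hi j hj h
    exact hf (by simpa using hi) (by simpa using hj) h
  have himg : (Finset.range M).image f = Finset.range M := by
    refine Finset.eq_of_subset_of_card_le ?_ ?_
    · intro j hj
      obtain ⟨i, hi, rfl⟩ := Finset.mem_image.1 hj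
      exact Finset.mem_range.2 (hM i (Finset.mem_range.1 hi))
    · rw [Finset.card_image_of_injOn hinj]
  rw [← Finset.sum_image (f := w) hinj, himg]

namespace EdgeList

variable {g : EdgeList} {w mate rmate : ℕ → ℕ}

theorem IsMatching.col_injOn {r : ℕ} (hm : g.IsMatching r mate rmate) :
    Set.InjOn (fun i => g.col (rmate i)) (Set.Iio r) := by
  intro i hi j hj h
  obtain ⟨-, h2, h3⟩ := hm.left i hi
  obtain ⟨-, h4, h5⟩ := hm.left j hj
  simp only at h
  rw [← h2, ← h4, ← h3, ← h5, h]

/-- A perfect matching that is supported by prices has minimal cost. -/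
theorem IsMatching.optimal (hg : g.WF) (hm : g.IsMatching g.M mate rmate)
    (hw : g.Supports w mate) {f e : ℕ → ℕ} (hf : Set.InjOn f (Set.Iio g.M))
    (he : ∀ i < g.M, g.Valid (e i) ∧ g.row (e i) = i ∧ g.col (e i) = f i) :
    ∑ i ∈ Finset.range g.M, g.cost (rmate i) ≤ ∑ i ∈ Finset.range g.M, g.cost (e i) := by
  have h1 : ∑ i ∈ Finset.range g.M, (g.cost (rmate i) + w (g.col (rmate i))) ≤
      ∑ i ∈ Finset.range g.M, (g.cost (e i) + w (f i)) := by
    refine Finset.sum_le_sum fun i hi => ?_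
    have hi := Finset.mem_range.1 hi
    obtain ⟨k1, k2, k3⟩ := hm.left i hi
    obtain ⟨l1, l2, l3⟩ := he i hi
    have h := hw.tight _ (hg.col_lt _ k1) (by rw [k3]; have := k1.1; omega) (e i) l1
      (by rw [k3, k2, l2])
    rwa [k3, l3] at h
  -- Both matchings use every column exactly once, so the sum of all prices occurs on both sides and
  -- cancels.
  rw [Finset.sum_add_distrib, Finset.sum_add_distrib,
    sum_comp_eq_sum_range (f := fun i => g.col (rmate i)) w hm.col_injOn
      (fun i hi => hg.col_lt _ (hm.left i hi).1),
    sum_comp_eq_sum_range (f := f) w hf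
      (fun i hi => (he i hi).2.2 ▸ hg.col_lt _ (he i hi).1)] at h1
  omega

end EdgeList

/-! ### The whole program: result and number of steps -/

namespace RAM

theorem writeResult_spec {s : State} :
    wp writeResult s (fun s' t => s'.reg 3 = (if s.reg 12 = s.reg 0 then 1 else 0) ∧
      (∀ k < s.reg 0, s'.arr 2 k = s.arr 5 (s.arr 9 k)) ∧ t ≤ 20 * s.reg 0 + 20) := by
  simp only [writeResult, wp_seq, wp_assign, Expr.eval, Expr.steps]
  refine wp_loop (fun s' m => s'.reg 21 ≤ s.reg 0 ∧
      (∀ k < s'.reg 21, s'.arr 2 k = s.arr 5 (s.arr 9 k)) ∧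
      m = 20 * (s.reg 0 - s'.reg 21)) (20 * s.reg 0) ?_ ?_ ?_
  · simp [State.setReg_reg]
  · rintro s' m hf ⟨h1, h2, h3⟩ hlt'
    have r0 := hf.reg 0 (by decide)
    have a5 := hf.arr 5 (by decide)
    have a9 := hf.arr 9 (by decide)
    simp [State.setReg_reg, State.setReg_arr] at r0 a5 a9
    simp [Expr.eval, r0] at hlt'
    simp only [wp_seq, wp_assign, wp_store, Expr.eval, Expr.steps, State.setReg_reg,
      State.setReg_arr, State.setArr_reg, State.setArr_arr, reduceIte, a5, a9]
    intro _
    refine ⟨_, ⟨by omega, fun k hk => ?_, rfl⟩, by omega⟩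
    by_cases hkk : k = s'.reg 21
    · simp [hkk]
    · rw [Function.update_of_ne hkk]
      exact h2 k (by omega)
  · rintro s' m t hf ⟨h1, h2, h3⟩ hlt' ht
    have r0 := hf.reg 0 (by decide)
    have r3 := hf.reg 3 (by decide)
    simp [State.setReg_reg] at r0 r3
    simp [Expr.eval, r0, Expr.steps] at hlt' ht
    exact ⟨r3, fun k hk => h2 k (by omega), by omega⟩

/-- The program computes a minimum-cost perfect matching among the pairs at distance at most `ρ`,
if there is one. -/
theorem jldi_spec {s : State} {M ρ n : ℕ} {D : ℕ → ℕ → ℕ} (hM : 0 < M) (hn : 0 < n)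
    (h0 : s.reg 0 = M) (h1 : s.reg 1 = n) (h2 : s.reg 2 = ρ)
    (h7 : ∀ j, s.arr 7 j = 0) (h8 : ∀ j, s.arr 8 j = 0)
    (hD : ∀ i < M, ∀ j < M, segmentDist (s.arr 0) (s.arr 1) n (i * n) (j * n) = D i j)
    (hDn : ∀ i j, D i j ≤ n) :
    wp jldi s (fun s' t =>
      (s'.reg 3 = 0 ∧ (∀ f : ℕ → ℕ, Set.InjOn f (Set.Iio M) → (∀ i < M, f i < M) →
          ¬ ∀ i < M, D i (f i) ≤ ρ) ∨
        s'.reg 3 = 1 ∧ Set.InjOn (s'.arr 2) (Set.Iio M) ∧ (∀ i < M, s'.arr 2 i < M) ∧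
          (∀ i < M, D i (s'.arr 2 i) ≤ ρ) ∧
          ∀ f : ℕ → ℕ, Set.InjOn f (Set.Iio M) → (∀ i < M, f i < M) →
            (∀ i < M, D i (f i) ≤ ρ) →
            ∑ i ∈ Finset.range M, D i (s'.arr 2 i) ≤ ∑ i ∈ Finset.range M, D i (f i)) ∧
      t ≤ 1000 * (M * (n * M + M + 1 +
        ∑ a ∈ Finset.range M, ∑ b ∈ Finset.range M, (if D a b ≤ ρ then 1 else 0)))) := by
  simp only [jldi, wp_seq]
  refine wp_of_frame ((listEdges_spec h0 h1 h2 hD).mono ?_)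
  rintro s₁ t₁ ⟨hL, hE, hr6, ht₁⟩ hf₁
  have hcount := hL.count
  rw [Finset.sum_range_zero, add_zero] at hcount
  set g : EdgeList := ⟨M, n, s₁.reg 10, s₁.arr 3, s₁.arr 4, s₁.arr 5, s₁.arr 6⟩ with hgdef
  have hg : g.WF := hL.wf hDn hE
  simp only [wp_assign, Expr.eval, Expr.steps]
  refine wp_loop (fun s' m => s'.reg 12 ≤ M ∧
      (s'.reg 23 = (if s'.reg 12 < M then 1 else 0) ∧
          g.IsMatching (s'.reg 12) (s'.arr 8) (s'.arr 9) ∧ g.Supports (s'.arr 7) (s'.arr 8) ∧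
          m = (M - s'.reg 12) * (200 * (n * M + s₁.reg 10 + M + 1) + 10) ∨
        s'.reg 23 = 0 ∧ s'.reg 12 < M ∧ ∀ f : ℕ → ℕ, Set.InjOn f (Set.Iio g.M) →
          ¬ ∀ i < g.M, ∃ e, g.Valid e ∧ g.row e = i ∧ g.col e = f i))
    (M * (200 * (n * M + s₁.reg 10 + M + 1) + 10)) ?_ ?_ ?_
  · have a7 := hf₁.arr 7 (by decide)
    have a8 := hf₁.arr 8 (by decide)
    simp only [State.setReg_reg, State.setReg_arr, reduceIte, Nat.reduceEqDiff, a7, a8, if_pos hM]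
    -- Zeroed memory represents the empty matching, supported by zero prices.
    refine ⟨Nat.zero_le _, .inl ⟨trivial, ⟨fun i hi => absurd hi (Nat.not_lt_zero _),
      fun j _ h => absurd (h8 j) h⟩, ⟨fun j _ h => absurd (h8 j) h, fun j _ _ => h7 j,
      fun j _ => ?_⟩, by simp⟩⟩
    rw [h7]
    exact Nat.zero_le _
  · rintro s' m hf ⟨k1, ⟨k4, k2, k3, hm⟩ | ⟨k4, -⟩⟩ hrun
    swap
    · exact absurd k4 hrun
    simp only [Expr.eval] at hrun
    have hlt : s'.reg 12 < M := by
      by_contra h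
      rw [if_neg h] at k4
      exact hrun k4
    have hs' : Holds g s' := by
      have r0 := hf.reg 0 (by decide)
      have r11 := hf.reg 11 (by decide)
      have a3 := hf.arr 3 (by decide)
      have a4 := hf.arr 4 (by decide)
      have a5 := hf.arr 5 (by decide)
      have a6 := hf.arr 6 (by decide)
      simp only [State.setReg_reg, State.setReg_arr, reduceIte, Nat.reduceEqDiff, hr6]
        at r0 r11 a3 a4 a5 a6
      rw [hf₁.reg 0 (by decide), h0] at r0
      refine ⟨r0, ?_, a3, a4, a5, a6⟩
      -- After the listing, register `6` has grown to `M * n`, so the number of buckets is formed by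
      -- additions alone.
      rw [r11, hgdef, mul_comm M n]
      ring
    refine (stage_spec hg k2 k3 hn hlt hs' rfl).mono ?_
    rintro s'' t ⟨hres, ht⟩ -
    have hM' : M - s'.reg 12 = M - (s'.reg 12 + 1) + 1 := by omega
    rw [hM', Nat.add_mul] at hm
    simp only [hgdef] at ht
    simp only [Expr.steps]
    rcases hres with ⟨l1, l2, l3, l4⟩ | ⟨l1, l2, l3⟩
    · refine ⟨(M - s''.reg 12) * (200 * (n * M + s₁.reg 10 + M + 1) + 10),
        ⟨by omega, .inl ⟨l1 ▸ l2, l1 ▸ l3, l4, rfl⟩⟩, ?_⟩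
      rw [l1]
      omega
    -- A failed search ends the loop, so no further time is reserved.
    · exact ⟨0, ⟨by omega, .inr ⟨l2, by omega, l3⟩⟩, by omega⟩
  · rintro s' m t hf ⟨k1, k4⟩ hrun ht
    simp only [Expr.eval] at hrun
    have r0 := hf.reg 0 (by decide)
    have a5 := hf.arr 5 (by decide)
    simp only [State.setReg_reg, State.setReg_arr, reduceIte, Nat.reduceEqDiff]
      at r0 a5
    rw [hf₁.reg 0 (by decide), h0] at r0
    simp only [Expr.steps] at ht
    refine writeResult_spec.mono ?_
    rintro s'' t' ⟨l1, l2, l3⟩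
    rw [r0] at l1 l2 l3
    rw [a5] at l2
    constructor
    · rcases k4 with ⟨k4, k2, k3, -⟩ | ⟨-, k4, k6⟩
      · have h12 : s'.reg 12 = M := by
          by_contra h
          rw [if_pos (by omega)] at k4
          omega
        rw [if_pos h12] at l1
        rw [h12] at k2
        refine .inr ⟨l1, ?_, ?_, ?_, ?_⟩
        · intro i hi j hj h
          rw [l2 i hi, l2 j hj] at h
          exact k2.col_injOn hi hj h
        · intro i hi
          rw [l2 i hi]
          exact hg.col_lt _ (k2.left i hi).1
        · intro i hi
          obtain ⟨v, hrow, -⟩ := k2.left i hi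
          obtain ⟨-, -, m1, m2, -⟩ := hL.edge _ v.1 v.2
          rw [l2 i hi]
          change s₁.arr 4 _ = i at hrow
          rw [hrow] at m1
          rwa [m1] at m2
        · intro f hf hfM hfD
          have hex : ∀ i, ∃ e, i < M → g.Valid e ∧ g.row e = i ∧ g.col e = f i := by
            intro i
            by_cases hi : i < M
            · obtain ⟨e, e1, e2, e3, e4⟩ := hL.all i (f i) (.inl ⟨hi, hfM i hi⟩) (hfD i hi)
              exact ⟨e, fun _ => ⟨⟨e1, e2⟩, e3, e4⟩⟩
            · exact ⟨0, fun h => absurd h hi⟩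
          choose e he using hex
          have hopt := k2.optimal hg k3 hf he
          have c1 : ∀ i ∈ Finset.range M, D i (s''.arr 2 i) = g.cost (s'.arr 9 i) := by
            intro i hi
            have hi := Finset.mem_range.1 hi
            obtain ⟨v, hrow, -⟩ := k2.left i hi
            obtain ⟨-, -, m1, -⟩ := hL.edge _ v.1 v.2
            rw [l2 i hi]
            change s₁.arr 4 _ = i at hrow
            rw [hrow] at m1
            exact m1.symm
          have c2 : ∀ i ∈ Finset.range M, D i (f i) = g.cost (e i) := by
            intro i hi
            obtain ⟨v, hrow, hcol⟩ := he i (Finset.mem_range.1 hi)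
            obtain ⟨-, -, m1, -⟩ := hL.edge _ v.1 v.2
            change s₁.arr 4 _ = i at hrow
            change s₁.arr 5 _ = f i at hcol
            rw [hrow, hcol] at m1
            exact m1.symm
          rw [Finset.sum_congr rfl c1, Finset.sum_congr rfl c2]
          exact hopt
      · rw [if_neg (by omega)] at l1
        refine .inl ⟨l1, fun f hf hfM hfD => k6 f hf fun i hi => ?_⟩
        obtain ⟨e, e1, e2, e3, e4⟩ := hL.all i (f i) (.inl ⟨hi, hfM i hi⟩) (hfD i hi)
        exact ⟨e, ⟨e1, e2⟩, e3, e4⟩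
    · rw [hcount] at ht
      set S := ∑ a ∈ Finset.range M, ∑ b ∈ Finset.range M, (if D a b ≤ ρ then 1 else 0)
      have : M ≤ M * M := Nat.le_mul_of_pos_left _ hM
      ring_nf at ht ht₁ ⊢
      omega

end RAM

/-! ### The program implements JLDI -/

namespace RAM

theorem wordsArray_apply {M n : ℕ} (w : Fin M → Word n) (i : Fin M) (k : Fin n) :
    wordsArray w (i * n + k) = (w i k).toNat := by
  have hn : 0 < n := k.pos
  have h1 : (i * n + k : ℕ) / n = i := by
    rw [mul_comm, Nat.mul_add_div hn, Nat.div_eq_of_lt k.isLt, add_zero]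
  have h2 : (i * n + k : ℕ) % n = k := by
    rw [mul_comm, Nat.mul_add_mod, Nat.mod_eq_of_lt k.isLt]
  rw [wordsArray, dif_pos ⟨by rw [h1]; exact i.isLt, by rw [h2]; exact k.isLt⟩]
  simp only [h1, h2]

theorem segmentDist_wordsArray {M n : ℕ} (x y : Fin M → Word n) (i j : Fin M) :
    segmentDist (wordsArray x) (wordsArray y) n (i * n) (j * n) = hammingDist (x i) (y j) := by
  rw [segmentDist, Finset.sum_range, hammingDist, Finset.card_filter]
  refine Finset.sum_congr rfl fun k _ => ?_
  rw [wordsArray_apply, wordsArray_apply]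
  cases x i k <;> cases y j k <;> rfl

end RAM

/-- Distances between the words of two lists, with natural numbers as indices. -/
def distNat {M n : ℕ} (x y : Fin M → Word n) (i j : ℕ) : ℕ :=
  if h : i < M ∧ j < M then hammingDist (x ⟨i, h.1⟩) (y ⟨j, h.2⟩) else 0

theorem distNat_apply {M n : ℕ} (x y : Fin M → Word n) (i j : Fin M) :
    distNat x y i j = hammingDist (x i) (y j) := by
  simp [distNat]

theorem distNat_le {M n : ℕ} (x y : Fin M → Word n) (i j : ℕ) : distNat x y i j ≤ n := by
  unfold distNat
  split_ifs
  · simpa using hammingDist_le_card_fintype (x := x ⟨i, _⟩) (y := y ⟨j, _⟩)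
  · exact Nat.zero_le _

/-- A permutation as a function on natural numbers. -/
def permNat {M : ℕ} (τ : Equiv.Perm (Fin M)) (i : ℕ) : ℕ :=
  if h : i < M then τ ⟨i, h⟩ else 0

theorem permNat_apply {M : ℕ} (τ : Equiv.Perm (Fin M)) (i : Fin M) : permNat τ i = τ i := by
  simp [permNat]

theorem permNat_lt {M : ℕ} (τ : Equiv.Perm (Fin M)) (i : ℕ) (hi : i < M) : permNat τ i < M := by
  simp [permNat, hi]

theorem permNat_injOn {M : ℕ} (τ : Equiv.Perm (Fin M)) :
    Set.InjOn (permNat τ) (Set.Iio M) := by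
  intro i hi j hj h
  have hi : i < M := hi
  have hj : j < M := hj
  have hτ : ((τ ⟨i, hi⟩ : Fin M) : ℕ) = τ ⟨j, hj⟩ := by simpa [permNat, hi, hj] using h
  simpa using τ.injective (Fin.ext hτ)

/-- A list-decodable code leads to a graph with few edges. -/
theorem IsListDecodable.sum_le {M n L : ℕ} {R : ℝ} {x : Fin M → Word n} (hR : 0 ≤ R)
    (hx : Function.Injective x) (hL : IsListDecodable (Set.range x) R L) (y : Fin M → Word n) :
    ∑ a ∈ Finset.range M, ∑ b ∈ Finset.range M, (if distNat x y a b ≤ ⌊R⌋₊ then 1 else 0) ≤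
      M * L := by
  -- List-decodability bounds balls around outputs, so the edges are counted column by column.
  rw [Finset.sum_comm]
  refine (Finset.sum_le_card_nsmul _ _ L fun b hb => ?_).trans (by simp)
  have hb := Finset.mem_range.1 hb
  have h1 : ∑ a ∈ Finset.range M, (if distNat x y a b ≤ ⌊R⌋₊ then 1 else 0) =
      (Finset.univ.filter fun a : Fin M => (hammingDist (x a) (y ⟨b, hb⟩) : ℝ) ≤ R).card := by
    rw [Finset.sum_range, Finset.card_filter]
    refine Finset.sum_congr rfl fun a _ => ?_
    have := distNat_apply x y a ⟨b, hb⟩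
    simp only at this
    simp only [this, Nat.le_floor_iff hR]
  rw [h1]
  refine le_trans (le_of_eq ?_) (hL (y ⟨b, hb⟩))
  rw [← Finset.card_image_of_injective _ hx, ← Set.ncard_coe_finset]
  congr 1
  ext c
  simp only [Finset.coe_image, Finset.coe_filter, Finset.mem_univ, true_and, Set.mem_image,
    Set.mem_range]
  constructor
  · rintro ⟨a, ha, rfl⟩
    exact ⟨⟨a, rfl⟩, ha⟩
  · rintro ⟨⟨a, rfl⟩, ha⟩
    exact ⟨a, ha, rfl⟩

theorem jldi_returns {M n L : ℕ} {R : ℝ} {x : Fin M → Word n} (hM : 0 < M) (hn : 0 < n)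
    (hR : 0 ≤ R) (hx : Function.Injective x) (hL : IsListDecodable (Set.range x) R L)
    (y : Fin M → Word n) :
    ∃ (t : ℕ) (o : Option (Equiv.Perm (Fin M))),
      RAM.Returns RAM.jldi x y R t o ∧ IsJLDIResult x y R o ∧
      (t : ℝ) ≤ 3000 * ((M : ℝ) ^ 2 * (Real.log M + L + n)) := by
  obtain ⟨t, s', hex, hres, ht⟩ := RAM.jldi_spec (s := RAM.input x y R) (M := M) (n := n)
    (ρ := ⌊R⌋₊) (D := distNat x y) hM hn rfl rfl rfl (fun _ => rfl) (fun _ => rfl)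
    (fun i hi j hj => by
      have h1 := RAM.segmentDist_wordsArray x y ⟨i, hi⟩ ⟨j, hj⟩
      have h2 := distNat_apply x y ⟨i, hi⟩ ⟨j, hj⟩
      exact h1.trans h2.symm) (distNat_le x y)
  have hadj : ∀ (i : Fin M) (j : Fin M),
      distNat x y i j ≤ ⌊R⌋₊ ↔ (jldiGraph x y R).Adj i j := by
    intro i j
    rw [distNat_apply, Nat.le_floor_iff hR]
    rfl
  have hperf : ∀ τ, (jldiGraph x y R).IsPerfectMatching τ →
      ∀ i < M, distNat x y i (permNat τ i) ≤ ⌊R⌋₊ := by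
    intro τ hτ i hi
    have := (hadj ⟨i, hi⟩ (τ ⟨i, hi⟩)).2 (hτ ⟨i, hi⟩)
    rwa [← permNat_apply] at this
  have hcost : ∀ τ, (jldiGraph x y R).matchingCost τ =
      ∑ i ∈ Finset.range M, distNat x y i (permNat τ i) := by
    intro τ
    rw [Finset.sum_range]
    refine Finset.sum_congr rfl fun i _ => ?_
    rw [permNat_apply, distNat_apply]
    rfl
  have htime : (t : ℝ) ≤ 3000 * ((M : ℝ) ^ 2 * (Real.log M + L + n)) := by
    have h1 := hL.sum_le hR hx y
    have h2 : t ≤ 3000 * (M * M * (L + n)) := by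
      refine ht.trans ?_
      -- Both `M` and `1` are at most `M * n`; the resulting factor 3 turns the constant 1000 of
      -- `RAM.jldi_spec` into 3000.
      have h3 : n * M + M + 1 + ∑ a ∈ Finset.range M, ∑ b ∈ Finset.range M,
          (if distNat x y a b ≤ ⌊R⌋₊ then 1 else 0) ≤ 3 * (M * (L + n)) := by
        have h4 : M ≤ M * n := Nat.le_mul_of_pos_right _ hn
        have h5 : M * (L + n) = M * L + M * n := by ring
        have h6 : n * M = M * n := by ring
        omega
      calc _ ≤ 1000 * (M * (3 * (M * (L + n)))) :=
            Nat.mul_le_mul_left _ (Nat.mul_le_mul_left _ h3)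
        _ = _ := by ring
    have h3 : (t : ℝ) ≤ 3000 * ((M : ℝ) * M * (L + n)) := by exact_mod_cast h2
    have h4 : 0 ≤ Real.log M := Real.log_natCast_nonneg M
    have h5 : 0 ≤ (M : ℝ) ^ 2 * Real.log M := by positivity
    nlinarith
  rcases hres with ⟨h3, hno⟩ | ⟨h3, hinj, hlt, hle, hopt⟩
  · refine ⟨t, none, ⟨s', hex, h3⟩, ?_, htime⟩
    intro τ hτ
    exact hno (permNat τ) (permNat_injOn τ) (permNat_lt τ) (hperf τ hτ)
  · have hbij : Function.Bijective
        (fun i : Fin M => (⟨s'.arr 2 i, hlt i i.isLt⟩ : Fin M)) := by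
      refine Finite.injective_iff_bijective.1 fun i j h => ?_
      exact Fin.ext (hinj i.isLt j.isLt (Fin.mk.inj_iff.1 h))
    set τ : Equiv.Perm (Fin M) := Equiv.ofBijective _ hbij with hτdef
    have hτ : ∀ i : Fin M, s'.arr 2 i = τ i := fun i => rfl
    have hc : ∑ i ∈ Finset.range M, distNat x y i (s'.arr 2 i) =
        ∑ i ∈ Finset.range M, distNat x y i (permNat τ i) := by
      refine Finset.sum_congr rfl fun i hi => ?_
      have hi := Finset.mem_range.1 hi
      rw [hτ ⟨i, hi⟩, ← permNat_apply]
    refine ⟨t, some τ, ⟨s', hex, h3, hτ⟩, ⟨?_, ?_⟩, htime⟩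
    · intro i
      rw [← hadj, ← hτ]
      exact hle i i.isLt
    · intro ρ hρ
      rw [hcost, hcost, ← hc]
      exact hopt _ (permNat_injOn ρ) (permNat_lt ρ) (hperf ρ hρ)

/-! ### The success probability -/

section Channel

variable {M n : ℕ} {p : ℝ}

/-- The weight of a pattern of correctly transmitted bits. -/
noncomputable def patternWeight (p : ℝ) (a : Fin M → Fin n → Bool) : ℝ :=
  ∏ i, ∏ k, if a i k then 1 - p else p

/-- The outputs of the channels for a pattern `a` of correctly transmitted bits. -/
def received (x : Fin M → Word n) (σ : Equiv.Perm (Fin M)) :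
    (Fin M → Fin n → Bool) ≃ (Fin M → Word n) where
  toFun a j k := (x (σ.symm j) k == a (σ.symm j) k)
  invFun y i k := (x i k == y (σ i) k)
  left_inv a := by
    funext i k
    simp
  right_inv y := by
    funext j k
    simp

theorem received_apply (x : Fin M → Word n) (σ : Equiv.Perm (Fin M))
    (a : Fin M → Fin n → Bool) (i : Fin M) (k : Fin n) :
    received x σ a (σ i) k = (x i k == a i k) := by
  simp [received]

open Classical in
-- In the coordinates of correct bits the law no longer depends on `x` or `σ`, and the patterns form
-- a distributive lattice in which larger means fewer errors.
theorem outputProb_eq_sum (x : Fin M → Word n) (σ : Equiv.Perm (Fin M))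
    (E : (Fin M → Word n) → Prop) :
    outputProb p x σ E =
      ∑ a, patternWeight p a * (if E (received x σ a) then 1 else 0) := by
  rw [outputProb, Finset.sum_filter, ← (received x σ).sum_comp]
  refine Finset.sum_congr rfl fun a _ => ?_
  rw [mul_ite, mul_one, mul_zero]
  refine if_congr Iff.rfl (Finset.prod_congr rfl fun i _ => Finset.prod_congr rfl fun k _ => ?_) rfl
  rw [received_apply]
  cases x i k <;> cases a i k <;> simp

theorem patternWeight_pos (hp : 0 < p) (hp' : p < 1) (a : Fin M → Fin n → Bool) :
    0 < patternWeight p a := by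
  refine Finset.prod_pos fun i _ => Finset.prod_pos fun k _ => ?_
  split_ifs <;> linarith

/-- In each coordinate, meet and join merely rearrange the two bits. This is the lattice condition
of the FKG inequality, with equality as for any product measure. -/
theorem patternWeight_mul (a b : Fin M → Fin n → Bool) :
    patternWeight p a * patternWeight p b =
      patternWeight p (a ⊓ b) * patternWeight p (a ⊔ b) := by
  simp only [patternWeight, ← Finset.prod_mul_distrib]
  refine Finset.prod_congr rfl fun i _ => Finset.prod_congr rfl fun k _ => ?_
  cases h : a i k <;> cases h' : b i k <;> (simp [h, h']; try ring)

theorem sum_patternWeight : ∑ a : Fin M → Fin n → Bool, patternWeight p a = 1 := by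
  have h1 : ∀ i : Fin M, ∑ b : Fin n → Bool, ∏ k, (if b k then 1 - p else p) = 1 := by
    intro _
    have := Finset.prod_univ_sum (fun _ : Fin n => (Finset.univ : Finset Bool))
      (fun _ b => if b then 1 - p else p)
    rw [Fintype.piFinset_univ] at this
    rw [← this]
    simp
  have := Finset.prod_univ_sum (fun _ : Fin M => (Finset.univ : Finset (Fin n → Bool)))
    (fun _ b => ∏ k, (if b k then 1 - p else p))
  rw [Fintype.piFinset_univ] at this
  simp only [patternWeight]
  rw [← this, Finset.prod_congr rfl fun i _ => h1 i]
  simp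

open Classical in
/-- Harris' inequality for the channel: events that are increasing in the pattern of correctly
transmitted bits are positively correlated. -/
theorem outputProb_mul_le (hp : 0 < p) (hp' : p < 1) (x : Fin M → Word n)
    (σ : Equiv.Perm (Fin M)) {A B : (Fin M → Word n) → Prop}
    (hA : ∀ a b, a ≤ b → A (received x σ a) → A (received x σ b))
    (hB : ∀ a b, a ≤ b → B (received x σ a) → B (received x σ b)) :
    outputProb p x σ A * outputProb p x σ B ≤ outputProb p x σ (fun y => A y ∧ B y) := by
  have hmono : ∀ E : (Fin M → Word n) → Prop,
      (∀ a b, a ≤ b → E (received x σ a) → E (received x σ b)) →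
      Monotone (fun a => if E (received x σ a) then (1 : ℝ) else 0) := by
    intro E hE a b hab
    by_cases h : E (received x σ a)
    · simp [h, hE a b hab h]
    · simp only [h, if_false]
      split_ifs <;> norm_num
  have hnn : ∀ E : (Fin M → Word n) → Prop,
      0 ≤ (fun a => if E (received x σ a) then (1 : ℝ) else 0) := by
    intro E a
    simp only [Pi.zero_apply]
    split_ifs <;> norm_num
  have h := fkg (fun a => if A (received x σ a) then (1 : ℝ) else 0)
    (fun a => if B (received x σ a) then (1 : ℝ) else 0) (patternWeight p)
    (fun a => (patternWeight_pos hp hp' a).le) (hnn A) (hnn B) (hmono A hA) (hmono B hB)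
    (fun a b => (patternWeight_mul a b).le)
  rw [sum_patternWeight, one_mul] at h
  simp only [outputProb_eq_sum]
  refine h.trans (le_of_eq (Finset.sum_congr rfl fun a _ => ?_))
  by_cases h1 : A (received x σ a) <;> by_cases h2 : B (received x σ a) <;> simp [h1, h2]

/-- Correcting bits of the outputs reduces the distances to the inputs by the number of changes. -/
theorem hammingDist_received {a b : Fin M → Fin n → Bool} (hab : a ≤ b) (x : Fin M → Word n)
    (σ : Equiv.Perm (Fin M)) (i : Fin M) :
    hammingDist (x i) (received x σ a (σ i)) = hammingDist (x i) (received x σ b (σ i)) +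
      hammingDist (received x σ a (σ i)) (received x σ b (σ i)) := by
  simp only [hammingDist, Finset.card_filter, ← Finset.sum_add_distrib]
  refine Finset.sum_congr rfl fun k _ => ?_
  have h := hab i k
  simp only [received_apply]
  revert h
  cases x i k <;> cases a i k <;> cases b i k <;> simp

theorem JMDICorrect_iff {x y : Fin M → Word n} {σ : Equiv.Perm (Fin M)} :
    JMDICorrect x y σ ↔ ∀ τ, τ ≠ σ →
      (jmdiGraph x y).matchingCost σ < (jmdiGraph x y).matchingCost τ := by
  constructor
  · rintro ⟨⟨-, h1⟩, h2⟩ τ hτ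
    by_contra h
    refine hτ (h2 τ ⟨fun _ => trivial, fun τ' hτ' => ?_⟩)
    exact (not_lt.1 h).trans (h1 τ' hτ')
  · intro h
    refine ⟨⟨fun _ => trivial, fun τ _ => ?_⟩, fun τ hτ => ?_⟩
    · by_cases hτ : τ = σ
      · rw [hτ]
      · exact (h τ hτ).le
    · by_contra hne
      exact absurd (hτ.2 σ fun _ => trivial) (not_le.2 (h τ hne))

/-- The corrections lower the cost of `σ` by exactly their number, since each one moves an output
towards its own input. By the triangle inequality they lower the cost of any other matching by at
most this number, so strict optimality persists. -/
theorem JMDICorrect.mono {x : Fin M → Word n} {σ : Equiv.Perm (Fin M)}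
    {a b : Fin M → Fin n → Bool} (hab : a ≤ b) (h : JMDICorrect x (received x σ a) σ) :
    JMDICorrect x (received x σ b) σ := by
  rw [JMDICorrect_iff] at h ⊢
  intro τ hτ
  have h1 := h τ hτ
  set y := received x σ a
  set y' := received x σ b
  have h2 : (jmdiGraph x y).matchingCost σ = (jmdiGraph x y').matchingCost σ +
      ∑ j, hammingDist (y j) (y' j) := by
    rw [← Equiv.sum_comp σ]
    simp only [CostBipartite.matchingCost, jmdiGraph, ← Finset.sum_add_distrib]
    exact Finset.sum_congr rfl fun i _ => hammingDist_received hab x σ i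
  have h3 : (jmdiGraph x y).matchingCost τ ≤ (jmdiGraph x y').matchingCost τ +
      ∑ j, hammingDist (y j) (y' j) := by
    rw [← Equiv.sum_comp τ]
    simp only [CostBipartite.matchingCost, jmdiGraph, ← Finset.sum_add_distrib]
    refine Finset.sum_le_sum fun i _ => ?_
    rw [hammingDist_comm (y (τ i))]
    exact hammingDist_triangle _ _ _
  omega

/-- The error-free pattern has positive weight. There `σ` costs nothing, while any other matching
joins two distinct codewords. -/
theorem outputProb_JMDICorrect_pos (hp : 0 < p) (hp' : p < 1) {x : Fin M → Word n}
    (hx : Function.Injective x) (σ : Equiv.Perm (Fin M)) :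
    0 < outputProb p x σ (fun y => JMDICorrect x y σ) := by
  classical
  rw [outputProb_eq_sum]
  refine Finset.sum_pos' (fun a _ => ?_) ⟨fun _ _ => true, Finset.mem_univ _, ?_⟩
  · have := patternWeight_pos hp hp' a
    positivity
  · have hy : ∀ j, received x σ (fun _ _ => true) j = x (σ.symm j) := by
      intro j
      funext k
      simp [received]
    have hc : JMDICorrect x (received x σ fun _ _ => true) σ := by
      rw [JMDICorrect_iff]
      intro τ hτ
      have h0 : (jmdiGraph x (received x σ fun _ _ => true)).matchingCost σ = 0 := by
        simp [CostBipartite.matchingCost, jmdiGraph, hy]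
      rw [h0]
      obtain ⟨i, hi⟩ : ∃ i, τ i ≠ σ i := by
        by_contra! h
        exact hτ (Equiv.ext h)
      refine Finset.sum_pos' (fun _ _ => Nat.zero_le _) ⟨i, Finset.mem_univ _, ?_⟩
      simp only [jmdiGraph, hy, hammingDist_pos]
      intro h
      exact hi ((Equiv.symm_apply_eq σ).1 (hx h).symm)
    rw [if_pos hc, mul_one]
    exact patternWeight_pos hp hp' _

/-- The generating function of the number of errors, which factors over the bits; at `s = 1` it
gives total mass 1. -/
theorem sum_bscProb_mul (p s : ℝ) (x : Word n) :
    ∑ z, bscProb p x z * s ^ hammingDist x z = (1 - p + p * s) ^ n := by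
  have h1 : ∀ z, bscProb p x z * s ^ hammingDist x z =
      ∏ k, if z k = x k then 1 - p else p * s := by
    intro z
    rw [bscProb, hammingDist, ← Finset.prod_const, Finset.prod_filter, ← Finset.prod_mul_distrib]
    refine Finset.prod_congr rfl fun k _ => ?_
    by_cases h : z k = x k
    · simp [h]
    · simp [h, Ne.symm h]
  simp only [h1]
  have := Finset.prod_univ_sum (fun _ : Fin n => (Finset.univ : Finset Bool))
    (fun k b => if b = x k then 1 - p else p * s)
  rw [Fintype.piFinset_univ] at this
  rw [← this]
  have h2 : ∀ k, ∑ b : Bool, (if b = x k then 1 - p else p * s) = 1 - p + p * s := by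
    intro k
    cases x k <;> simp [add_comm]
  rw [Finset.prod_congr rfl fun k _ => h2 k]
  simp

theorem bscProb_nonneg (hp : 0 < p) (hp' : p < 1) (x z : Word n) : 0 ≤ bscProb p x z := by
  refine Finset.prod_nonneg fun k _ => ?_
  split_ifs <;> linarith

/-- The Chernoff bound for the number of errors in a word. -/
theorem sum_bscProb_tail_le (hp : 0 < p) (hp' : p < 1) (x : Word n) {R γ : ℝ} (hγ : 0 < γ)
    (hR : R = (1 + γ) * (p * n)) :
    ∑ z, (if (hammingDist x z : ℝ) ≤ R then 0 else bscProb p x z) ≤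
      Real.exp (-(γ ^ 2 * (p * n) / (2 + γ))) := by
  have hs : (0 : ℝ) < 1 + γ := by linarith
  have hlog : 0 ≤ Real.log (1 + γ) := Real.log_nonneg (by linarith)
  -- Markov's inequality for `s ^ hammingDist x z` with `s = 1 + γ`, the ratio of `R` to the mean.
  have h1 : ∀ z, (if (hammingDist x z : ℝ) ≤ R then 0 else bscProb p x z) ≤
      bscProb p x z * (1 + γ) ^ hammingDist x z * Real.exp (-(R * Real.log (1 + γ))) := by
    intro z
    have hb := bscProb_nonneg hp hp' x z
    split_ifs with h
    · positivity
    · rw [mul_assoc]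
      refine le_mul_of_one_le_right hb ?_
      have : (1 + γ) ^ hammingDist x z = Real.exp (hammingDist x z * Real.log (1 + γ)) := by
        rw [Real.exp_nat_mul, Real.exp_log hs]
      rw [this, ← Real.exp_add]
      refine Real.one_le_exp ?_
      nlinarith [not_le.1 h]
  refine (Finset.sum_le_sum fun z _ => h1 z).trans ?_
  rw [← Finset.sum_mul, sum_bscProb_mul]
  have h2 : (1 - p + p * (1 + γ)) ^ n ≤ Real.exp (n * (p * γ)) := by
    rw [Real.exp_nat_mul]
    refine pow_le_pow_left₀ (by nlinarith) ?_ n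
    have := Real.add_one_le_exp (p * γ)
    linarith
  refine (mul_le_mul_of_nonneg_right h2 (Real.exp_pos _).le).trans ?_
  rw [← Real.exp_add]
  refine Real.exp_le_exp.2 ?_
  -- The bound `2γ/(γ+2)` for the logarithm turns the exponent `(1+γ) log(1+γ) - γ` into `γ²/(2+γ)`.
  have h3 := Real.le_log_one_add_of_nonneg hγ.le
  have h4 : γ ^ 2 / (2 + γ) = (1 + γ) * (2 * γ / (γ + 2)) - γ := by
    field_simp
    ring
  have h5 : γ ^ 2 * (p * n) / (2 + γ) = (p * n) * ((1 + γ) * (2 * γ / (γ + 2)) - γ) := by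
    rw [← h4]
    ring
  rw [h5, hR]
  have h6 : (1 + γ) * (2 * γ / (γ + 2)) ≤ (1 + γ) * Real.log (1 + γ) :=
    mul_le_mul_of_nonneg_left h3 hs.le
  have h7 : 0 ≤ p * n := by positivity
  nlinarith [mul_le_mul_of_nonneg_left h6 h7]

theorem sum_bscProb_ge (hp : 0 < p) (hp' : p < 1) (x : Word n) {R γ : ℝ} (hγ : 0 < γ)
    (hR : R = (1 + γ) * (p * n)) :
    1 - Real.exp (-(γ ^ 2 * (p * n) / (2 + γ))) ≤
      ∑ z, (if (hammingDist x z : ℝ) ≤ R then bscProb p x z else 0) := by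
  have h1 := sum_bscProb_tail_le hp hp' x hγ hR
  have h2 := sum_bscProb_mul p 1 x
  simp only [one_pow, mul_one, sub_add_cancel] at h2
  have h3 : ∑ z, (if (hammingDist x z : ℝ) ≤ R then 0 else bscProb p x z) +
      ∑ z, (if (hammingDist x z : ℝ) ≤ R then bscProb p x z else 0) = 1 := by
    rw [← Finset.sum_add_distrib, ← h2]
    refine Finset.sum_congr rfl fun z _ => ?_
    split_ifs <;> simp
  linarith

/-- Independence of the channels, after the outputs have been relabelled by `σ`. -/
theorem outputProb_forall (x : Fin M → Word n) (σ : Equiv.Perm (Fin M)) (R : ℝ) :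
    outputProb p x σ (fun y => ∀ i, (hammingDist (x i) (y (σ i)) : ℝ) ≤ R) =
      ∏ i, ∑ z, (if (hammingDist (x i) z : ℝ) ≤ R then bscProb p (x i) z else 0) := by
  classical
  have := Finset.prod_univ_sum (fun _ : Fin M => (Finset.univ : Finset (Word n)))
    (fun i z => if (hammingDist (x i) z : ℝ) ≤ R then bscProb p (x i) z else 0)
  rw [Fintype.piFinset_univ] at this
  rw [this, outputProb, Finset.sum_filter, ← (Equiv.arrowCongr σ (Equiv.refl (Word n))).sum_comp]
  refine Finset.sum_congr rfl fun y _ => ?_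
  simp only [Equiv.arrowCongr_apply, Function.comp, Equiv.symm_apply_apply, Equiv.refl_apply]
  split_ifs with h
  · exact Finset.prod_congr rfl fun i _ => by rw [if_pos (h i)]
  · push Not at h
    obtain ⟨i, hi⟩ := h
    exact (Finset.prod_eq_zero (Finset.mem_univ i) (if_neg (not_le.2 hi))).symm

/-- If all distances are at most `R`, then JLDI finds what JMDI finds. -/
theorem IsJLDIResult.eq_some {x y : Fin M → Word n} {R : ℝ} {σ : Equiv.Perm (Fin M)}
    {o : Option (Equiv.Perm (Fin M))} (ho : IsJLDIResult x y R o)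
    (hR : ∀ i, (hammingDist (x i) (y (σ i)) : ℝ) ≤ R) (hσ : JMDICorrect x y σ) :
    o = some σ := by
  cases o with
  | none => exact absurd hR (ho σ)
  | some τ =>
    by_contra hne
    have h1 := JMDICorrect_iff.1 hσ τ fun h => hne (by rw [h])
    exact absurd (ho.2 σ hR) (not_le.2 h1)

theorem outputProb_mono (hp : 0 < p) (hp' : p < 1) (x : Fin M → Word n)
    (σ : Equiv.Perm (Fin M)) {A B : (Fin M → Word n) → Prop} (h : ∀ y, A y → B y) :
    outputProb p x σ A ≤ outputProb p x σ B := by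
  classical
  rw [outputProb_eq_sum, outputProb_eq_sum]
  refine Finset.sum_le_sum fun a _ => mul_le_mul_of_nonneg_left ?_ (patternWeight_pos hp hp' a).le
  by_cases h1 : A (received x σ a)
  · simp [h1, h _ h1]
  · simp only [h1, if_false]
    split_ifs <;> norm_num

theorem le_condOutputProb {c : RAM.Program} {R γ : ℝ} (hp : 0 < p) (hp' : p < 1)
    {x : Fin M → Word n} (hx : Function.Injective x) (hγ : 0 < γ) (hR : R = (1 + γ) * (p * n))
    (hc : ∀ y, ∃ t o, RAM.Returns c x y R t o ∧ IsJLDIResult x y R o)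
    (σ : Equiv.Perm (Fin M)) :
    (1 - Real.exp (-(γ ^ 2 * (p * n) / (2 + γ)))) ^ M ≤
      condOutputProb p x σ (fun y => ∃ t, RAM.Returns c x y R t (some σ))
        (fun y => JMDICorrect x y σ) := by
  rw [condOutputProb, le_div_iff₀ (outputProb_JMDICorrect_pos hp hp' hx σ)]
  -- Correcting bits never increases an error count, so this event is increasing, as Harris'
  -- inequality requires.
  have hA : ∀ a b, a ≤ b →
      (∀ i, (hammingDist (x i) (received x σ a (σ i)) : ℝ) ≤ R) →
      ∀ i, (hammingDist (x i) (received x σ b (σ i)) : ℝ) ≤ R := by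
    intro a b hab h i
    refine le_trans ?_ (h i)
    rw [hammingDist_received hab x σ i]
    exact_mod_cast Nat.le_add_right _ _
  have h1 : (1 - Real.exp (-(γ ^ 2 * (p * n) / (2 + γ)))) ^ M ≤
      outputProb p x σ (fun y => ∀ i, (hammingDist (x i) (y (σ i)) : ℝ) ≤ R) := by
    rw [outputProb_forall]
    have h0 : 0 ≤ 1 - Real.exp (-(γ ^ 2 * (p * n) / (2 + γ))) := by
      rw [sub_nonneg]
      refine Real.exp_le_one_iff.2 (neg_nonpos.2 ?_)
      positivity
    calc (1 - Real.exp (-(γ ^ 2 * (p * n) / (2 + γ)))) ^ M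
        = ∏ _i : Fin M, (1 - Real.exp (-(γ ^ 2 * (p * n) / (2 + γ)))) := by simp
      _ ≤ _ := Finset.prod_le_prod (fun _ _ => h0) fun i _ => sum_bscProb_ge hp hp' (x i) hγ hR
  refine (mul_le_mul_of_nonneg_right h1 (outputProb_JMDICorrect_pos hp hp' hx σ).le).trans ?_
  refine (outputProb_mul_le hp hp' x σ hA fun a b hab h => h.mono hab).trans ?_
  refine outputProb_mono hp hp' x σ fun y hy => ⟨?_, hy.2⟩
  obtain ⟨t, o, h2, h3⟩ := hc y
  rw [h3.eq_some hy.1 hy.2] at h2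
  exact ⟨t, h2⟩

end Channel

theorem mainTheorem3 :
    ∃ (jldi : RAM.Program) (K : ℝ),
      ∀ (M n L : ℕ) (p R : ℝ) (x : Fin M → Word n),
        0 < M → 0 < n → 0 < p → p < 1 → p * n < R →
        Function.Injective x → IsListDecodable (Set.range x) R L →
        -- the program implements JLDI and meets the time bound, on all channel outputs
        (∀ y : Fin M → Word n, ∃ (t : ℕ) (o : Option (Equiv.Perm (Fin M))),
          RAM.Returns jldi x y R t o ∧ IsJLDIResult x y R o ∧
          (t : ℝ) ≤ K * ((M : ℝ) ^ 2 * (Real.log M + L + n))) ∧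
        -- the probability bound, for every true permutation
        (∀ (σ : Equiv.Perm (Fin M)) (γ : ℝ), γ = R / (p * n) - 1 →
          0 < outputProb p x σ (fun y => JMDICorrect x y σ) ∧
          (γ ≤ 1 →
            (1 - Real.exp (-(γ ^ 2 * (p * n) / 3))) ^ M ≤
              condOutputProb p x σ (fun y => ∃ t, RAM.Returns jldi x y R t (some σ))
                (fun y => JMDICorrect x y σ)) ∧
          (1 - Real.exp (-(γ ^ 2 * (p * n) / (2 + γ)))) ^ M ≤
            condOutputProb p x σ (fun y => ∃ t, RAM.Returns jldi x y R t (some σ))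
              (fun y => JMDICorrect x y σ)) := by
  refine ⟨RAM.jldi, 3000, fun M n L p R x hM hn hp hp' hR hx hL => ?_⟩
  have hn' : (0 : ℝ) < n := Nat.cast_pos.2 hn
  have hpn : 0 < p * n := mul_pos hp hn'
  have hruns := jldi_returns hM hn (hpn.trans hR).le hx hL
  refine ⟨hruns, fun σ γ hγ => ?_⟩
  have hγ0 : 0 < γ := by
    rw [hγ, sub_pos, lt_div_iff₀ hpn, one_mul]
    exact hR
  have hRγ : R = (1 + γ) * (p * n) := by
    rw [hγ]
    field_simp
    ring
  have hmain := le_condOutputProb (c := RAM.jldi) hp hp' hx hγ0 hRγ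
    (fun y => by
      obtain ⟨t, o, h1, h2, -⟩ := hruns y
      exact ⟨t, o, h1, h2⟩) σ
  refine ⟨outputProb_JMDICorrect_pos hp hp' hx σ, fun hγ1 => le_trans ?_ hmain, hmain⟩
  have h0 : Real.exp (-(γ ^ 2 * (p * n) / 3)) ≤ 1 := by
    refine Real.exp_le_one_iff.2 (neg_nonpos.2 ?_)
    positivity
  refine pow_le_pow_left₀ (sub_nonneg.2 h0) ?_ M
  refine sub_le_sub_left (Real.exp_le_exp.2 (neg_le_neg ?_)) 1
  -- For `γ ≤ 1` the denominator `2 + γ` is at most 3, so the first bound follows from the second.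
  exact div_le_div_of_nonneg_left (by positivity) (by positivity) (by linarith)
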